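/- Let $\mathbb T$ be the unit circle with normalized Lebesgue measure $\ell$ ($d\ell=d\theta/2\pi$); all $L^p$ norms and all integrals $\int_J\cdot$ below are taken with respect to $\ell$. Let $\mathbb D$ be the open unit disk, let $I\subset\mathbb T$ be measurable with complement $J=\mathbb T\setminus I$, and suppose that $\ell(I)>0$, $\ell(J)>0$ and $\ell(\partial I)=0$. For functions $h_1$ on $I$ and $h_2$ on $J$, write $h_1\vee h_2$ for the function on $\mathbb T$ equal to $h_1$ on $I$ and to $h_2$ on $J$. The Hardy space $H^2$ is the set of functions in $L^2(\mathbb T)$ whose Fourier coefficients of strictly negative index vanish; its members are identified with holomorphic functions in $\mathbb D$ through the Cauchy integral $g(z)=\frac1{2i\pi}\int_{\mathbb T}\frac{g(\xi)}{\xi-z}\,d\xi$. The anti-analytic projection on $L^2(\mathbb T)$ is $\mathbf P_-\bigl(\sum_{n\in\mathbb Z}a_ne^{in\theta}\bigr)=\sum_{n<0}a_ne^{in\theta}$. Let $M\in L^2(J)$ be non-negative with $\log M\in L^1(J)$, and let $f\in L^2(I)$ be such that there is no $g\in H^2$ with $g=f$ a.e. on $I$ and $|g|\le M$ a.e. on $J$.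 Let $\mu\ge0$ be a function on $J$ with $\mu M^2\in L^1(J)$ and $\log\mu\in L^1(J)$ (so $M>0$ and $\mu>0$ a.e. on $J$, as $\log 0=-\infty$). Let $$w_{\mu^{1/2}}(z)=\exp\Bigl\{\frac1{2\pi}\int_{0}^{2\pi}\frac{e^{i\theta}+z}{e^{i\theta}-z}\,\log\bigl(1\vee\mu^{1/2}\bigr)(e^{i\theta})\,d\theta\Bigr\},\qquad z\in\mathbb D,$$ be the outer function with modulus $1$ a.e. on $I$ and $\mu^{1/2}$ a.e. on $J$; on $\mathbb T$ it is understood through its nontangential boundary values. Define $$\Phi_M(\mu)=\inf_{g\in H^2}\ \Bigl(\|f-g\|^2_{L^2(I)}+\int_J\mu\,(|g|^2-M^2)\,d\ell\Bigr),$$ where the integral over $J$ is $+\infty$ if $\mu|g|^2\notin L^1(J)$. Then: 1. $fw_{\mu^{1/2}}\vee0\in L^2(\mathbb T)$ and $$\Phi_M(\mu)=\bigl\|\mathbf P_-\bigl(fw_{\mu^{1/2}}\vee0\bigr)\bigr\|^2_{L^2(\mathbb T)}-\bigl\|\mu^{1/2}M\bigr\|^2_{L^2(J)}.$$ 2. Put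 $$g_\mu(z)=\frac1{2i\pi\,w_{\mu^{1/2}}(z)}\int_I\frac{w_{\mu^{1/2}}(\xi)f(\xi)}{\xi-z}\,d\xi,\qquad z\in\mathbb D.$$ If $g_\mu\in H^2$, then the infimum defining $\Phi_M(\mu)$ is attained at $g=g_\mu$. 3. If $1/\mu\in L^\infty(J)$, then $g_\mu\in H^2$; hence, by 2, the infimum is attained at $g_\mu$. -/

import Mathlib

open MeasureTheory

namespace HardyDual

instance factTwoPiPos : Fact (0 < 2 * Real.pi) := ⟨Real.two_pi_pos⟩

/-- The unit circle, parametrized by the angle `θ` modulo `2π`. -/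
abbrev Torus : Type := AddCircle (2 * Real.pi)

/-- The point `e^{iθ}` of the complex plane. -/
noncomputable def pt (θ : Torus) : ℂ := (AddCircle.toCircle θ : ℂ)

/-- The normalized Lebesgue measure of the circle, `dθ / 2π`. -/
noncomputable abbrev ell : Measure Torus := AddCircle.haarAddCircle

/-- The Hilbert space `L²(𝕋)`. -/
abbrev L2T : Type := Lp ℂ 2 ell

/-- The Hardy space `H²`: functions in `L²(𝕋)` whose Fourier coefficients of strictly negative
index vanish. -/
def H2 : Set L2T := {g | ∀ n : ℤ, n < 0 → fourierCoeff (g : Torus → ℂ) n = 0}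

/-- The anti-analytic projection on `L²(𝕋)`:
`∑ aₙ e^{inθ} ↦ ∑_{n < 0} aₙ e^{inθ}` (the series converges in `L²(𝕋)`). -/
noncomputable def Pminus (u : L2T) : L2T :=
  ∑' n : ℤ, if n < 0 then fourierCoeff (u : Torus → ℂ) n • fourierLp 2 n else 0

open Classical in
/-- The concatenation `h₁ ∨ h₂`, equal to `h₁` on `S` and to `h₂` on the complement of `S`. -/
noncomputable def concat {α : Type*} (S : Set Torus) (h₁ h₂ : Torus → α) (t : Torus) : α :=
  if t ∈ S then h₁ t else h₂ t

/-- The line integral `∫_S F(ξ) dξ` over a subset `S` of the circle; with `ξ = e^{iθ}` one has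
`dξ = i e^{iθ} dθ = 2πi ξ (dθ / 2π)`. -/
noncomputable def lineIntegral (S : Set Torus) (F : Torus → ℂ) : ℂ :=
  ∫ t in S, F t * (2 * Real.pi * Complex.I * pt t) ∂ell

/-- The Cauchy integral `(1 / 2πi) ∫_𝕋 h(ξ) / (ξ - z) dξ`, which for `h ∈ H²` is the holomorphic
function in the disk with boundary values `h`. -/
noncomputable def cauchyExt (h : Torus → ℂ) (z : ℂ) : ℂ :=
  1 / (2 * Complex.I * Real.pi) * lineIntegral Set.univ (fun t => h t / (pt t - z))

/-- The function `F` on the disk is the member of `H²` with boundary values `g`. -/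
def IsH2With (F : ℂ → ℂ) (g : L2T) : Prop :=
  g ∈ H2 ∧ ∀ z ∈ Metric.ball (0 : ℂ) 1, F z = cauchyExt (g : Torus → ℂ) z

/-- The outer function in the disk with boundary modulus `ρ`. -/
noncomputable def outer (ρ : Torus → ℝ) (z : ℂ) : ℂ :=
  Complex.exp (∫ t, (pt t + z) / (pt t - z) * (Real.log (ρ t) : ℂ) ∂ell)

/-- The nontangential approach region (Stolz region) of aperture `α` at `e^{iθ}`. -/
def stolz (α : ℝ) (t : Torus) : Set ℂ :=
  {z | ‖z‖ < 1 ∧ ‖z - pt t‖ < α * (1 - ‖z‖)}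

/-- Nontangential approach to `e^{iθ}` from inside the disk: a function tends to `c` along this
filter iff it does so in each region `stolz α`, `α > 1`. -/
noncomputable def ntFilter (t : Torus) : Filter ℂ :=
  ⨆ α : {α : ℝ // 1 < α}, nhdsWithin (pt t) (stolz α t)

/-- The nontangential boundary values of a function on the disk. -/
noncomputable def bdry (F : ℂ → ℂ) (t : Torus) : ℂ := Filter.limUnder (ntFilter t) F

/-- `w_{μ^{1/2}}`: the outer function with modulus `1` on `S` and `μ^{1/2}` off `S`. -/
noncomputable def wSqrt (S : Set Torus) (μ : Torus → ℝ) : ℂ → ℂ :=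
  outer (concat S (fun _ => 1) (fun t => Real.sqrt (μ t)))

/-- The extended integral `∫ h⁺ - ∫ h⁻` of a real function. -/
noncomputable def eintegral (ν : Measure Torus) (h : Torus → ℝ) : EReal :=
  ((∫⁻ t, ENNReal.ofReal (h t) ∂ν : ENNReal) : EReal) -
    ((∫⁻ t, ENNReal.ofReal (-h t) ∂ν : ENNReal) : EReal)

/-- The class `L¹₊(M²dθ, J)`, `J` the complement of `S`: non-negative functions `μ` with
`μ M² ∈ L¹(J)` and `log μ ∈ L¹(J)`. As `log 0 = -∞`, the last condition forces `μ > 0` a.e. -/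
structure MemL1Plus (S : Set Torus) (M μ : Torus → ℝ) : Prop where
  pos : ∀ᵐ t ∂ell.restrict Sᶜ, 0 < μ t
  integrable : Integrable (fun t => μ t * M t ^ 2) (ell.restrict Sᶜ)
  integrable_log : Integrable (fun t => Real.log (μ t)) (ell.restrict Sᶜ)

/-- The criterion `‖f - g‖²_{L²(S)} + ∫_{𝕋∖S} μ (|g|² - M²)`, possibly `+∞`. -/
noncomputable def criterion (S : Set Torus) (f : Torus → ℂ) (M μ : Torus → ℝ) (g : L2T) : EReal :=
  ((eLpNorm (fun t => f t - g t) 2 (ell.restrict S) ^ 2 : ENNReal) : EReal) +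
    eintegral (ell.restrict Sᶜ) (fun t => μ t * (‖g t‖ ^ 2 - M t ^ 2))

/-- The dual functional `Φ_M(μ)`. -/
noncomputable def dualFunctional (S : Set Torus) (f : Torus → ℂ) (M μ : Torus → ℝ) : EReal :=
  ⨅ g ∈ H2, criterion S f M μ g

/-- The Carleman-type function
`g_μ(z) = (1 / (2iπ w_{μ^{1/2}}(z))) ∫_S w_{μ^{1/2}}(ξ) f(ξ) / (ξ - z) dξ`. -/
noncomputable def carleman (S : Set Torus) (f : Torus → ℂ) (μ : Torus → ℝ) (z : ℂ) : ℂ :=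
  1 / (2 * Complex.I * Real.pi * wSqrt S μ z) *
    lineIntegral S (fun t => bdry (wSqrt S μ) t * f t / (pt t - z))

end HardyDual

/-!
The outer function `w = w_{μ^{1/2}}` has boundary modulus `1` on `S` and `μ^{1/2}` off `S`, so with
`u = fw ∨ 0` the criterion at `g` is `‖u - gw‖² - ‖μ^{1/2} M‖²`, and it is `+∞` when `gw ∉ L²`. If
`gw ∈ L²` then `gw ∈ H²`, so by orthogonality the criterion is
`‖P₋ u‖² + ‖(u - P₋ u) - gw‖² - ‖μ^{1/2} M‖²`. The products `gw ∈ L²`, `g ∈ H²`, are dense in `H²`,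
hence the value of the infimum; it is attained when `gw = u - P₋ u`, that is for the quotient
`g_μ = (u - P₋ u) / w` as soon as this is in `H²`, for instance when `1 / w` is bounded.

Membership of `gw` in `H²` and density both rest on one approximation. For `ρ = μ^{1/2}` extended by
`1`, the bounded weights `cutoff ρ n = min 1 ((n + 1) ρ)` increase to `1`, their outer functions
tend to `1`, and `outer ρ⁻¹ * outer (cutoff ρ n)` is bounded by `n + 1`.
-/

namespace HardyDual

open scoped ComplexConjugate Topology
open Filter

theorem norm_pt (t : Torus) : ‖pt t‖ = 1 := Circle.norm_coe _

theorem continuous_pt : Continuous pt :=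
  continuous_induced_dom.comp AddCircle.continuous_toCircle

theorem pt_mul_conj (t : Torus) : pt t * conj (pt t) = 1 := by
  rw [Complex.mul_conj, Complex.normSq_eq_norm_sq, norm_pt]; simp

theorem pt_coe (x : ℝ) : pt (x : Torus) = Complex.exp (x * Complex.I) := by
  rw [pt, AddCircle.toCircle_apply_mk, Circle.coe_exp, div_self Real.two_pi_pos.ne', one_mul]

theorem fourier_natCast (n : ℕ) (t : Torus) : fourier (n : ℤ) t = pt t ^ n := by
  rw [fourier_apply, natCast_zsmul, AddCircle.toCircle_nsmul, Circle.coe_pow]; rfl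

theorem fourier_neg_natCast (n : ℕ) (t : Torus) : fourier (-(n : ℤ)) t = conj (pt t) ^ n := by
  rw [fourier_neg, fourier_natCast, map_pow]

theorem norm_fourier_apply (n : ℤ) (t : Torus) : ‖fourier n t‖ = 1 := by
  rw [fourier_apply]; exact Circle.norm_coe _

theorem one_sub_norm_le_norm_pt_sub (t : Torus) (z : ℂ) : 1 - ‖z‖ ≤ ‖pt t - z‖ := by
  simpa only [norm_pt] using norm_sub_norm_le (pt t) z

theorem pt_sub_ne_zero {z : ℂ} (hz : ‖z‖ < 1) (t : Torus) : pt t - z ≠ 0 :=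
  norm_pos_iff.mp ((sub_pos.mpr hz).trans_le (one_sub_norm_le_norm_pt_sub t z))

theorem dist_le_norm_pt_sub (s t : Torus) : dist s t ≤ Real.pi / 2 * ‖pt s - pt t‖ := by
  induction s using QuotientAddGroup.induction_on with | H x =>
  induction t using QuotientAddGroup.induction_on with | H y =>
  set u := toIocMod Real.two_pi_pos (-Real.pi) (x - y)
  have hdist : dist (x : Torus) y = ‖(u : Torus)‖ := by
    rw [dist_eq_norm, ← AddCircle.coe_sub]
    exact congrArg norm (Real.Angle.coe_toIocMod (x - y) (-Real.pi)).symm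
  calc dist (x : Torus) y = ‖(u : Torus)‖ := hdist
    _ ≤ ‖u‖ := QuotientAddGroup.norm_mk_le_norm
    _ = InnerProductGeometry.angle (pt x) (pt y) := by
      rw [pt_coe, pt_coe, Complex.angle_exp_exp, Real.norm_eq_abs]
    _ ≤ _ := Complex.angle_le_mul_norm_sub (norm_pt _) (norm_pt _)

theorem integral_pt_eq_circleAverage {E : Type*} [NormedAddCommGroup E] [NormedSpace ℝ E]
    (f : ℂ → E) : ∫ t, f (pt t) ∂ell = Real.circleAverage f 0 1 := by
  rw [AddCircle.integral_haarAddCircle, ← AddCircle.intervalIntegral_preimage _ 0]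
  simp [Real.circleAverage, pt_coe, circleMap]

section ApproximateIdentity

theorem exists_dyadic_le {δ d : ℝ} (hδ : 0 < δ) {N : ℕ} (hd : d ≤ 2 ^ N * δ) :
    ∃ k ≤ N, d ≤ 2 ^ k * δ ∧ δ / max δ d ^ 2 ≤ 4 * (1 / 4) ^ k / δ := by
  classical
  have hex : ∃ k : ℕ, d ≤ 2 ^ k * δ := ⟨N, hd⟩
  refine ⟨Nat.find hex, Nat.find_min' hex hd, Nat.find_spec hex, ?_⟩
  rcases hk : Nat.find hex with _ | j
  · calc δ / max δ d ^ 2 ≤ δ / δ ^ 2 := by gcongr; exact le_max_left _ _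
      _ = 1 / δ := by field_simp
      _ ≤ 4 * (1 / 4) ^ 0 / δ := by gcongr; norm_num
  · have hj : 2 ^ j * δ < d := not_le.mp (Nat.find_min hex (hk ▸ j.lt_succ_self))
    calc δ / max δ d ^ 2 ≤ δ / (2 ^ j * δ) ^ 2 := by
          gcongr; exact hj.le.trans (le_max_right _ _)
      _ = 4 * (1 / 4) ^ (j + 1) / δ := by
          rw [show (1 / 4 : ℝ) = (2 ^ 2)⁻¹ by norm_num, inv_pow, ← pow_mul, pow_mul', pow_succ 2]
          field_simp
          norm_num

theorem tendsto_tsum_two_pow_inv_mul {mean : ℝ → ℝ} {C : ℝ} (hbound : ∀ r, 0 < r → |mean r| ≤ C)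
    (hlim : Tendsto mean (𝓝[>] 0) (𝓝 0)) :
    Tendsto (fun δ => ∑' k : ℕ, (1 / 2) ^ k * mean (2 ^ k * δ)) (𝓝[>] 0) (𝓝 0) := by
  have hterm : ∀ k : ℕ, Tendsto (fun δ => (1 / 2) ^ k * mean (2 ^ k * δ)) (𝓝[>] 0) (𝓝 0) := by
    intro k
    have hscale : Tendsto (fun δ : ℝ => 2 ^ k * δ) (𝓝[>] 0) (𝓝[>] 0) := by
      refine tendsto_nhdsWithin_iff.mpr ⟨?_, ?_⟩
      · exact tendsto_nhdsWithin_of_tendsto_nhds (Continuous.tendsto' (by fun_prop) _ _ (by simp))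
      · filter_upwards [self_mem_nhdsWithin] with δ hδ
        exact mul_pos (by positivity) (Set.mem_Ioi.mp hδ)
    simpa only [mul_zero, Function.comp_apply] using (hlim.comp hscale).const_mul ((1 / 2 : ℝ) ^ k)
  have hdom : ∀ᶠ δ in 𝓝[>] (0 : ℝ), ∀ k : ℕ,
      ‖(1 / 2) ^ k * mean (2 ^ k * δ)‖ ≤ (1 / 2) ^ k * C := by
    filter_upwards [self_mem_nhdsWithin] with δ (hδ : 0 < δ) k
    rw [norm_mul, Real.norm_of_nonneg (by positivity), Real.norm_eq_abs]
    gcongr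
    exact hbound _ (by positivity)
  simpa only [tsum_zero] using
    tendsto_tsum_of_dominated_convergence (summable_geometric_two.mul_right C) hterm hdom

variable {X : Type*} [PseudoMetricSpace X] [MeasurableSpace X]
  {ν : Measure X} {ψ : X → ℝ}

theorem integral_dyadic_le [OpensMeasurableSpace X] (hψ : Integrable ψ ν)
    (hψ_nonneg : ∀ s, 0 ≤ ψ s) {δ : ℝ} (hδ : 0 < δ) {N : ℕ} {t : X}
    (hN : ∀ s, dist s t ≤ 2 ^ N * δ) :
    ∫ s, δ / max δ (dist s t) ^ 2 * ψ s ∂ν ≤ ∑ k ∈ Finset.range (N + 1),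
      4 * (1 / 2) ^ k * ((∫ s in Metric.closedBall t (2 ^ k * δ), ψ s ∂ν) / (2 ^ k * δ)) := by
  set ball : ℕ → Set X := fun k => Metric.closedBall t (2 ^ k * δ)
  have hball : ∀ k, MeasurableSet (ball k) := fun k => Metric.isClosed_closedBall.measurableSet
  have hterm_nonneg : ∀ k s, 0 ≤ 4 * (1 / 4) ^ k / δ * (ball k).indicator ψ s := fun k s =>
    mul_nonneg (by positivity) (Set.indicator_nonneg (fun s _ => hψ_nonneg s) s)
  have hpointwise : ∀ s, δ / max δ (dist s t) ^ 2 * ψ s ≤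
      ∑ k ∈ Finset.range (N + 1), 4 * (1 / 4) ^ k / δ * (ball k).indicator ψ s := by
    intro s
    obtain ⟨k, hkN, hk, hle⟩ := exists_dyadic_le hδ (hN s)
    calc δ / max δ (dist s t) ^ 2 * ψ s ≤ 4 * (1 / 4) ^ k / δ * (ball k).indicator ψ s := by
          rw [Set.indicator_of_mem (show s ∈ ball k from hk)]
          exact mul_le_mul_of_nonneg_right hle (hψ_nonneg s)
      _ ≤ _ := Finset.single_le_sum (fun k _ => hterm_nonneg k s)
          (Finset.mem_range.mpr (Nat.lt_succ_of_le hkN))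
  have hint : ∀ k, Integrable (fun s => 4 * (1 / 4) ^ k / δ * (ball k).indicator ψ s) ν :=
    fun k => (hψ.indicator (hball k)).const_mul _
  refine (integral_mono_of_nonneg
    (Eventually.of_forall fun s => mul_nonneg (by positivity) (hψ_nonneg s))
    (integrable_finsetSum _ fun k _ => hint k) (Eventually.of_forall hpointwise)).trans_eq ?_
  rw [integral_finsetSum _ fun k _ => hint k]
  refine Finset.sum_congr rfl fun k _ => ?_
  have hquarter : (1 / 4 : ℝ) ^ k = (1 / 2) ^ k / 2 ^ k := by rw [← div_pow]; norm_num
  rw [integral_const_mul, integral_indicator (hball k), hquarter]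
  ring

theorem exists_bound_integral_closedBall_div (hψ : Integrable ψ ν) (hψ_nonneg : ∀ s, 0 ≤ ψ s)
    {t : X}
    (hlim : Tendsto (fun r => (∫ s in Metric.closedBall t r, ψ s ∂ν) / r) (𝓝[>] 0) (𝓝 0)) :
    ∃ C, ∀ r, 0 < r → (∫ s in Metric.closedBall t r, ψ s ∂ν) / r ≤ C := by
  obtain ⟨r₀, hr₀, hsmall⟩ :=
    mem_nhdsGT_iff_exists_Ioo_subset.mp (hlim.eventually_lt_const one_pos)
  refine ⟨max 1 ((∫ s, ψ s ∂ν) / r₀), fun r hr => ?_⟩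
  rcases lt_or_ge r r₀ with h | h
  · exact (hsmall ⟨hr, h⟩ : _ < _).le.trans (le_max_left _ _)
  · exact (div_le_div₀ (integral_nonneg hψ_nonneg)
      (setIntegral_le_integral hψ (Eventually.of_forall hψ_nonneg)) hr₀ h).trans (le_max_right _ _)

theorem tendsto_integral_div_max_sq_mul [OpensMeasurableSpace X] [BoundedSpace X]
    (hψ : Integrable ψ ν) (hψ_nonneg : ∀ s, 0 ≤ ψ s) {t : X}
    (hlim : Tendsto (fun r => (∫ s in Metric.closedBall t r, ψ s ∂ν) / r) (𝓝[>] 0) (𝓝 0)) :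
    Tendsto (fun δ => ∫ s, δ / max δ (dist s t) ^ 2 * ψ s ∂ν) (𝓝[>] 0) (𝓝 0) := by
  set mean : ℝ → ℝ := fun r => (∫ s in Metric.closedBall t r, ψ s ∂ν) / r
  have hmean_nonneg : ∀ r, 0 < r → 0 ≤ mean r := fun r hr =>
    div_nonneg (integral_nonneg hψ_nonneg) hr.le
  obtain ⟨C, hC⟩ := exists_bound_integral_closedBall_div hψ hψ_nonneg hlim
  have htail := tendsto_tsum_two_pow_inv_mul
    (fun r hr => (abs_of_nonneg (hmean_nonneg r hr)).trans_le (hC r hr)) hlim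
  obtain ⟨D, hD⟩ := Metric.isBounded_iff.mp (Bornology.IsBounded.all (Set.univ : Set X))
  refine squeeze_zero' ?_ ?_ (by simpa only [mul_zero] using htail.const_mul 4) <;>
    filter_upwards [self_mem_nhdsWithin] with δ (hδ : 0 < δ)
  · exact integral_nonneg fun s => mul_nonneg (by positivity) (hψ_nonneg s)
  obtain ⟨N, hN⟩ := pow_unbounded_of_one_lt (D / δ) (one_lt_two (α := ℝ))
  have hdist : ∀ s, dist s t ≤ 2 ^ N * δ := fun s =>
    (hD (Set.mem_univ s) (Set.mem_univ t)).trans ((div_lt_iff₀ hδ).mp hN).le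
  have hterm_nonneg : ∀ k : ℕ, 0 ≤ (1 / 2) ^ k * mean (2 ^ k * δ) := fun k =>
    mul_nonneg (by positivity) (hmean_nonneg _ (by positivity))
  have hsummable : Summable fun k : ℕ => (1 / 2) ^ k * mean (2 ^ k * δ) :=
    .of_nonneg_of_le hterm_nonneg
      (fun k => mul_le_mul_of_nonneg_left (hC _ (by positivity)) (by positivity))
      (summable_geometric_two.mul_right C)
  calc ∫ s, δ / max δ (dist s t) ^ 2 * ψ s ∂ν
      ≤ ∑ k ∈ Finset.range (N + 1), 4 * (1 / 2) ^ k * mean (2 ^ k * δ) :=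
        integral_dyadic_le hψ hψ_nonneg hδ hdist
    _ = 4 * ∑ k ∈ Finset.range (N + 1), (1 / 2) ^ k * mean (2 ^ k * δ) := by
        simp_rw [Finset.mul_sum, mul_assoc]
    _ ≤ _ := by
        gcongr
        exact hsummable.sum_le_tsum _ fun k _ => hterm_nonneg k

end ApproximateIdentity

section PoissonIntegral

theorem poissonKernel_pt (z : ℂ) (t : Torus) :
    poissonKernel 0 z (pt t) = (1 - ‖z‖ ^ 2) / ‖pt t - z‖ ^ 2 := by
  simp [poissonKernel, norm_pt]

theorem poissonKernel_pt_nonneg {z : ℂ} (hz : ‖z‖ < 1) (t : Torus) :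
    0 ≤ poissonKernel 0 z (pt t) := by
  rw [poissonKernel_pt]
  exact div_nonneg (sub_nonneg.mpr (pow_le_one₀ (norm_nonneg z) hz.le)) (by positivity)

theorem continuous_poissonKernel_pt {z : ℂ} (hz : ‖z‖ < 1) :
    Continuous fun t => poissonKernel 0 z (pt t) := by
  simp_rw [poissonKernel_pt]
  exact continuous_const.div ((continuous_pt.sub continuous_const).norm.pow 2) fun t =>
    pow_ne_zero 2 (norm_ne_zero_iff.mpr (pt_sub_ne_zero hz t))

theorem integral_poissonKernel_pt {z : ℂ} (hz : ‖z‖ < 1) :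
    ∫ t, poissonKernel 0 z (pt t) ∂ell = 1 := by
  have h := (diffContOnCl_const (𝕜 := ℂ) (c := (1 : ℂ))).circleAverage_poissonKernel_smul
    (show z ∈ Metric.ball 0 1 by simpa using hz)
  rw [← integral_pt_eq_circleAverage] at h
  simpa [integral_complex_ofReal] using h

theorem poissonKernel_pt_le_of_mem_stolz {α : ℝ} {t : Torus} {z : ℂ} (hz : z ∈ stolz α t)
    (s : Torus) : poissonKernel 0 z (pt s) ≤ 2 * max 1 (Real.pi / 2 * (1 + α)) ^ 2 *
      ((1 - ‖z‖) / max (1 - ‖z‖) (dist s t) ^ 2) := by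
  obtain ⟨hz1, hz2⟩ := hz
  set δ := 1 - ‖z‖
  set D := max 1 (Real.pi / 2 * (1 + α))
  have hδ : 0 < δ := sub_pos.mpr hz1
  have hα : 0 < α := pos_of_mul_pos_left ((norm_nonneg _).trans_lt hz2) hδ.le
  have hδ_le : δ ≤ ‖pt s - z‖ := one_sub_norm_le_norm_pt_sub s z
  have hdist : dist s t ≤ Real.pi / 2 * (1 + α) * ‖pt s - z‖ :=
    calc dist s t ≤ Real.pi / 2 * ‖pt s - pt t‖ := dist_le_norm_pt_sub s t
      _ ≤ Real.pi / 2 * (‖pt s - z‖ + α * ‖pt s - z‖) := by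
        gcongr
        refine (norm_sub_le_norm_sub_add_norm_sub _ z _).trans ?_
        gcongr
        exact hz2.le.trans (by gcongr)
      _ = _ := by ring
  have hmax : max δ (dist s t) ≤ D * ‖pt s - z‖ := max_le
    (hδ_le.trans (le_mul_of_one_le_left (norm_nonneg _) (le_max_left _ _)))
    (hdist.trans (by gcongr; exact le_max_right _ _))
  have hD : 0 < D := one_pos.trans_le (le_max_left _ _)
  calc poissonKernel 0 z (pt s) = (1 - ‖z‖ ^ 2) / ‖pt s - z‖ ^ 2 := poissonKernel_pt z s
    _ ≤ 2 * δ / (max δ (dist s t) / D) ^ 2 := by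
      gcongr
      · nlinarith [norm_nonneg z]
      · rwa [div_le_iff₀' hD]
    _ = _ := by field_simp

theorem volume_eq_smul_ell : (volume : Measure Torus) = ENNReal.ofReal (2 * Real.pi) • ell :=
  AddCircle.volume_eq_smul_haarAddCircle

theorem integral_closedBall_div_le_average {ψ : Torus → ℝ} (hψ : ∀ s, 0 ≤ ψ s) (t : Torus) {r : ℝ}
    (hr : 0 < r) : (∫ s in Metric.closedBall t r, ψ s ∂ell) / r ≤
      1 / Real.pi * ⨍ s in Metric.closedBall t r, ψ s := by
  have hvol : volume.real (Metric.closedBall t r) ≤ 2 * r := by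
    rw [measureReal_def, AddCircle.volume_closedBall]
    exact ENNReal.toReal_le_of_le_ofReal (by positivity)
      (ENNReal.ofReal_le_ofReal (min_le_right _ _))
  rw [div_le_iff₀ hr]
  calc ∫ s in Metric.closedBall t r, ψ s ∂ell
      = 1 / (2 * Real.pi) * ∫ s in Metric.closedBall t r, ψ s := by
        rw [volume_eq_smul_ell, Measure.restrict_smul, integral_smul_measure,
          ENNReal.toReal_ofReal Real.two_pi_pos.le, smul_eq_mul]
        field_simp
    _ = 1 / (2 * Real.pi) * (volume.real (Metric.closedBall t r) *
          ⨍ s in Metric.closedBall t r, ψ s) := by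
        rw [← smul_eq_mul (volume.real _), measure_smul_setAverage _ (measure_ne_top _ _)]
    _ ≤ 1 / (2 * Real.pi) * (2 * r * ⨍ s in Metric.closedBall t r, ψ s) := by
        gcongr
        exact integral_nonneg hψ
    _ = _ := by field_simp

theorem ae_tendsto_integral_closedBall_div {E : Type*} [NormedAddCommGroup E] {a : Torus → E}
    (ha : Integrable a ell) : ∀ᵐ t ∂ell,
      Tendsto (fun r => (∫ s in Metric.closedBall t r, ‖a s - a t‖ ∂ell) / r) (𝓝[>] 0) (𝓝 0) := by
  have hloc : LocallyIntegrable a (volume : Measure Torus) := by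
    rw [volume_eq_smul_ell]
    exact (ha.smul_measure ENNReal.ofReal_ne_top).locallyIntegrable
  have hlebesgue := IsUnifLocDoublingMeasure.ae_tendsto_average_norm_sub volume hloc 1
  rw [volume_eq_smul_ell,
    Measure.ae_ennreal_smul_measure_iff (ENNReal.ofReal_pos.mpr Real.two_pi_pos).ne',
    ← volume_eq_smul_ell] at hlebesgue
  filter_upwards [hlebesgue] with t ht
  have hmean := ht (l := 𝓝[>] 0) (fun _ => t) id tendsto_id (by
    filter_upwards [self_mem_nhdsWithin] with r hr
    exact Metric.mem_closedBall_self (by simpa using (Set.mem_Ioi.mp hr).le))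
  refine squeeze_zero' ?_ ?_ (by simpa only [mul_zero] using hmean.const_mul (1 / Real.pi)) <;>
    filter_upwards [self_mem_nhdsWithin] with r (hr : 0 < r)
  · exact div_nonneg (integral_nonneg fun s => norm_nonneg _) hr.le
  · exact integral_closedBall_div_le_average (fun s => norm_nonneg _) t hr

variable {E : Type*} [NormedAddCommGroup E] [NormedSpace ℝ E]

/-- The Poisson integral of a function on the circle, at a point of the disk. -/
noncomputable def poissonIntegral (a : Torus → E) (z : ℂ) : E :=
  ∫ t, poissonKernel 0 z (pt t) • a t ∂ell

theorem integrable_poissonKernel_pt_smul {a : Torus → E} (ha : Integrable a ell) {z : ℂ}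
    (hz : ‖z‖ < 1) : Integrable (fun t => poissonKernel 0 z (pt t) • a t) ell := by
  rw [← integrableOn_univ] at ha ⊢
  exact ha.continuousOn_smul (continuous_poissonKernel_pt hz).continuousOn isCompact_univ

theorem poissonIntegral_mono {a b : Torus → ℝ} (ha : Integrable a ell) (hb : Integrable b ell)
    (hab : a ≤ᵐ[ell] b) {z : ℂ} (hz : ‖z‖ < 1) : poissonIntegral a z ≤ poissonIntegral b z := by
  refine integral_mono_ae (integrable_poissonKernel_pt_smul ha hz)
    (integrable_poissonKernel_pt_smul hb hz) ?_
  filter_upwards [hab] with t ht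
  exact mul_le_mul_of_nonneg_left ht (poissonKernel_pt_nonneg hz t)

theorem poissonIntegral_const [CompleteSpace E] (c : E) {z : ℂ} (hz : ‖z‖ < 1) :
    poissonIntegral (fun _ => c) z = c := by
  rw [poissonIntegral, integral_smul_const, integral_poissonKernel_pt hz, one_smul]

theorem norm_poissonIntegral_sub_le [CompleteSpace E] {a : Torus → E} (ha : Integrable a ell)
    (c : E) {z : ℂ} (hz : ‖z‖ < 1) :
    ‖poissonIntegral a z - c‖ ≤ ∫ s, poissonKernel 0 z (pt s) * ‖a s - c‖ ∂ell := by
  have hsub : poissonIntegral a z - c = ∫ s, poissonKernel 0 z (pt s) • (a s - c) ∂ell := by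
    conv_lhs => rw [← poissonIntegral_const c hz, poissonIntegral, poissonIntegral]
    rw [← integral_sub (integrable_poissonKernel_pt_smul ha hz)
      (integrable_poissonKernel_pt_smul (integrable_const c) hz)]
    simp only [smul_sub]
  rw [hsub]
  refine (norm_integral_le_integral_norm _).trans_eq (integral_congr_ae (.of_forall fun s => ?_))
  simp only [norm_smul, Real.norm_of_nonneg (poissonKernel_pt_nonneg hz s)]

theorem tendsto_one_sub_norm_stolz (α : ℝ) (t : Torus) :
    Tendsto (fun z : ℂ => 1 - ‖z‖) (𝓝[stolz α t] (pt t)) (𝓝[>] 0) := by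
  refine tendsto_nhdsWithin_iff.mpr ⟨?_, ?_⟩
  · exact tendsto_nhdsWithin_of_tendsto_nhds
      (Continuous.tendsto' (by fun_prop) _ _ (by rw [norm_pt, sub_self]))
  · filter_upwards [self_mem_nhdsWithin] with z hz
    exact sub_pos.mpr hz.1

theorem tendsto_poissonIntegral_stolz [CompleteSpace E] {a : Torus → E} (ha : Integrable a ell)
    {t : Torus} (ht : Tendsto (fun r => (∫ s in Metric.closedBall t r, ‖a s - a t‖ ∂ell) / r)
      (𝓝[>] 0) (𝓝 0)) (α : ℝ) :
    Tendsto (poissonIntegral a) (𝓝[stolz α t] (pt t)) (𝓝 (a t)) := by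
  have hint : Integrable (fun s => ‖a s - a t‖) ell := (ha.sub (integrable_const _)).norm
  have hdyadic := (tendsto_integral_div_max_sq_mul hint (fun s => norm_nonneg _) ht).comp
    (tendsto_one_sub_norm_stolz α t)
  rw [tendsto_iff_norm_sub_tendsto_zero]
  refine squeeze_zero' (.of_forall fun z => norm_nonneg _) ?_ (by
    simpa only [mul_zero] using hdyadic.const_mul (2 * max 1 (Real.pi / 2 * (1 + α)) ^ 2))
  filter_upwards [self_mem_nhdsWithin] with z hz
  have hδ : 0 < 1 - ‖z‖ := sub_pos.mpr hz.1
  refine (norm_poissonIntegral_sub_le ha (a t) hz.1).trans ?_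
  rw [Function.comp_apply, ← integral_const_mul]
  have hcont : Continuous fun s => (1 - ‖z‖) / max (1 - ‖z‖) (dist s t) ^ 2 :=
    continuous_const.div (by fun_prop) fun s => by
      have : 0 < max (1 - ‖z‖) (dist s t) := hδ.trans_le (le_max_left _ _)
      positivity
  refine integral_mono (integrable_poissonKernel_pt_smul hint hz.1) ?_ fun s => ?_
  · rw [← integrableOn_univ] at hint ⊢
    exact (hint.continuousOn_mul hcont.continuousOn isCompact_univ).const_mul _
  · rw [← mul_assoc]
    exact mul_le_mul_of_nonneg_right (poissonKernel_pt_le_of_mem_stolz hz s) (norm_nonneg _)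

/-- **Fatou's theorem**: on a Stolz region the Poisson kernel is dominated by dyadic averages around
the vertex, so the Poisson integral converges at each Lebesgue point. -/
theorem ae_tendsto_poissonIntegral [CompleteSpace E] {a : Torus → E} (ha : Integrable a ell) :
    ∀ᵐ t ∂ell, Tendsto (poissonIntegral a) (ntFilter t) (𝓝 (a t)) := by
  filter_upwards [ae_tendsto_integral_closedBall_div ha] with t ht
  rw [ntFilter, tendsto_iSup]
  exact fun α => tendsto_poissonIntegral_stolz ha ht α

end PoissonIntegral

section Nontangential

theorem one_sub_mul_pt_mem_stolz {ε : ℝ} (hε : 0 < ε) (hε' : ε ≤ 1) (t : Torus) :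
    ((1 - ε : ℝ) : ℂ) * pt t ∈ stolz 2 t := by
  have hnorm : ‖((1 - ε : ℝ) : ℂ) * pt t‖ = 1 - ε := by
    rw [norm_mul, norm_pt, mul_one, Complex.norm_real, Real.norm_of_nonneg (by linarith)]
  have hdist : ‖((1 - ε : ℝ) : ℂ) * pt t - pt t‖ = ε := by
    rw [show ((1 - ε : ℝ) : ℂ) * pt t - pt t = -((ε : ℝ) : ℂ) * pt t by push_cast; ring,
      norm_mul, norm_pt, norm_neg, Complex.norm_real, Real.norm_of_nonneg hε.le, mul_one]
  exact ⟨by rw [hnorm]; linarith, by rw [hdist, hnorm]; linarith⟩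

instance ntFilter_neBot (t : Torus) : (ntFilter t).NeBot := by
  have hradial : Tendsto (fun ε : ℝ => ((1 - ε : ℝ) : ℂ) * pt t) (𝓝[>] 0)
      (𝓝[stolz 2 t] (pt t)) := by
    refine tendsto_nhdsWithin_iff.mpr ⟨?_, ?_⟩
    · exact tendsto_nhdsWithin_of_tendsto_nhds (Continuous.tendsto' (by fun_prop) _ _ (by simp))
    · filter_upwards [Ioc_mem_nhdsGT one_pos] with ε hε
      exact one_sub_mul_pt_mem_stolz hε.1 hε.2 t
  exact hradial.neBot.mono
    (le_iSup (fun α : {α : ℝ // 1 < α} => 𝓝[stolz α t] (pt t)) ⟨2, one_lt_two⟩)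

theorem eventually_norm_lt_one_ntFilter (t : Torus) : ∀ᶠ z in ntFilter t, ‖z‖ < 1 := by
  rw [ntFilter, eventually_iSup]
  intro α
  filter_upwards [self_mem_nhdsWithin] with z hz
  exact hz.1

theorem tendsto_of_eqOn_ball {F G : ℂ → ℂ} (h : ∀ z, ‖z‖ < 1 → F z = G z) {t : Torus} {c : ℂ}
    (hF : Tendsto F (ntFilter t) (𝓝 c)) : Tendsto G (ntFilter t) (𝓝 c) :=
  hF.congr' ((eventually_norm_lt_one_ntFilter t).mono h)

end Nontangential

section CauchyIntegral

theorem one_div_mul_lineIntegral_div (S : Set Torus) (F : Torus → ℂ) (z : ℂ) :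
    1 / (2 * Complex.I * Real.pi) * lineIntegral S (fun t => F t / (pt t - z)) =
      ∫ t in S, F t * (pt t / (pt t - z)) ∂ell := by
  rw [lineIntegral, ← integral_const_mul]
  refine integral_congr_ae (.of_forall fun t => ?_)
  have hpi : (Real.pi : ℂ) ≠ 0 := by exact_mod_cast Real.pi_ne_zero
  simp only
  field_simp

theorem cauchyExt_eq_integral (a : Torus → ℂ) (z : ℂ) :
    cauchyExt a z = ∫ t, a t * (pt t / (pt t - z)) ∂ell := by
  rw [cauchyExt, one_div_mul_lineIntegral_div, Measure.restrict_univ]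

theorem integrable_mul_pt_div {a : Torus → ℂ} (ha : Integrable a ell) {z : ℂ} (hz : ‖z‖ < 1) :
    Integrable (fun t => a t * (pt t / (pt t - z))) ell := by
  have hkernel : Continuous fun t => pt t / (pt t - z) :=
    continuous_pt.div (continuous_pt.sub continuous_const) (pt_sub_ne_zero hz)
  rw [← integrableOn_univ] at ha ⊢
  exact ha.mul_continuousOn hkernel.continuousOn isCompact_univ

theorem norm_mul_conj_pt (z : ℂ) (t : Torus) : ‖z * conj (pt t)‖ = ‖z‖ := by
  rw [norm_mul, RCLike.norm_conj, norm_pt, mul_one]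

theorem hasSum_pt_div_pt_sub {z : ℂ} (hz : ‖z‖ < 1) (t : Torus) :
    HasSum (fun n : ℕ => (z * conj (pt t)) ^ n) (pt t / (pt t - z)) := by
  have hgeom := hasSum_geometric_of_norm_lt_one (ξ := z * conj (pt t))
    (by rwa [norm_mul_conj_pt])
  have hinv : pt t / (pt t - z) = (1 - z * conj (pt t))⁻¹ := by
    rw [← pt_mul_conj t, ← sub_mul, mul_inv, inv_eq_of_mul_eq_one_left (pt_mul_conj t),
      div_eq_inv_mul]
  rwa [hinv]

theorem hasSum_cauchyExt {a : Torus → ℂ} (ha : Integrable a ell) {z : ℂ} (hz : ‖z‖ < 1) :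
    HasSum (fun n : ℕ => fourierCoeff a n * z ^ n) (cauchyExt a z) := by
  have hcont : Continuous fun t : Torus => conj (pt t) :=
    Complex.continuous_conj.comp continuous_pt
  have hterm_norm : ∀ (n : ℕ) t, ‖(z * conj (pt t)) ^ n‖ = ‖z‖ ^ n := fun n t => by
    rw [norm_pow, norm_mul_conj_pt]
  have hseries := hasSum_integral_of_summable_integral_norm (μ := ell)
    (F := fun (n : ℕ) t => a t * (z * conj (pt t)) ^ n)
    (fun n => ha.mul_bdd (c := ‖z‖ ^ n) (Continuous.aestronglyMeasurable (by fun_prop))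
      (.of_forall fun t => (hterm_norm n t).le)) (by
      simp_rw [norm_mul, hterm_norm, integral_mul_const]
      exact (summable_geometric_of_lt_one (norm_nonneg z) hz).mul_left _)
  simp_rw [tsum_mul_left, (hasSum_pt_div_pt_sub hz _).tsum_eq, ← cauchyExt_eq_integral] at hseries
  refine hseries.congr_fun fun n => ?_
  rw [fourierCoeff, ← integral_mul_const]
  refine integral_congr_ae (.of_forall fun t => ?_)
  simp only [fourier_neg_natCast, smul_eq_mul, mul_pow]
  ring

theorem differentiableOn_cauchyExt {a : Torus → ℂ} (ha : Integrable a ell) :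
    DifferentiableOn ℂ (cauchyExt a) (Metric.ball 0 1) := by
  intro z hz
  obtain ⟨r, hzr, hr1⟩ := exists_between (mem_ball_zero_iff.mp hz)
  have hr0 : 0 ≤ r := (norm_nonneg z).trans hzr.le
  have hsum : Summable fun n : ℕ => ‖fourierCoeff a n‖ * r ^ n := by
    have h := (hasSum_cauchyExt ha (z := (r : ℂ))
      (by rwa [Complex.norm_real, Real.norm_of_nonneg hr0])).summable.norm
    simpa only [norm_mul, norm_pow, Complex.norm_real, Real.norm_of_nonneg hr0] using h
  have hdiff : DifferentiableOn ℂ (fun w => ∑' n : ℕ, fourierCoeff a n * w ^ n)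
      (Metric.ball 0 r) := by
    refine Complex.differentiableOn_tsum_of_summable_norm hsum (fun n => by fun_prop)
      Metric.isOpen_ball fun n w hw => ?_
    rw [norm_mul, norm_pow]
    gcongr
    exact (mem_ball_zero_iff.mp hw).le
  have heq : Set.EqOn (cauchyExt a) (fun w => ∑' n : ℕ, fourierCoeff a n * w ^ n)
      (Metric.ball 0 r) := fun w hw =>
    (hasSum_cauchyExt ha ((mem_ball_zero_iff.mp hw).trans hr1)).tsum_eq.symm
  exact ((hdiff.congr heq).differentiableAt
    (Metric.isOpen_ball.mem_nhds (mem_ball_zero_iff.mpr hzr))).differentiableWithinAt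

theorem integrable_conj {a : Torus → ℂ} (ha : Integrable a ell) :
    Integrable (fun t => conj (a t)) ell :=
  Complex.conjCLE.toContinuousLinearMap.integrable_comp ha

theorem fourierCoeff_conj (a : Torus → ℂ) (n : ℤ) :
    fourierCoeff (fun t => conj (a t)) n = conj (fourierCoeff a (-n)) := by
  rw [fourierCoeff, fourierCoeff, ← integral_conj]
  simp only [smul_eq_mul, map_mul, ← fourier_neg, neg_neg]

theorem poissonKernel_pt_eq_add_conj {z : ℂ} (hz : ‖z‖ < 1) (t : Torus) :
    (poissonKernel 0 z (pt t) : ℂ) = pt t / (pt t - z) + conj (pt t / (pt t - z)) - 1 := by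
  have hkernel : herglotzRieszKernel 0 z (pt t) = 2 * (pt t / (pt t - z)) - 1 := by
    have := pt_sub_ne_zero hz t
    simp only [herglotzRieszKernel, sub_zero]
    field_simp
    ring
  rw [congrFun (poissonKernel_eq_re_herglotzRieszKernel (c := 0) (w := z)) (pt t),
    Function.comp_apply, hkernel, Complex.add_conj]
  simp

theorem poissonIntegral_eq_add_conj {a : Torus → ℂ} (ha : Integrable a ell) {z : ℂ}
    (hz : ‖z‖ < 1) : poissonIntegral a z =
      cauchyExt a z + conj (cauchyExt (fun t => conj (a t)) z) - fourierCoeff a 0 := by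
  have hanti := integrable_conj (integrable_mul_pt_div (integrable_conj ha) hz)
  have hsum : Integrable (fun t => a t * (pt t / (pt t - z)) +
      conj (conj (a t) * (pt t / (pt t - z)))) ell := (integrable_mul_pt_div ha hz).add hanti
  have hsplit : ∀ t, poissonKernel 0 z (pt t) • a t = a t * (pt t / (pt t - z)) +
      conj (conj (a t) * (pt t / (pt t - z))) - a t := fun t => by
    rw [Complex.real_smul, poissonKernel_pt_eq_add_conj hz, map_mul, Complex.conj_conj]
    ring
  simp_rw [poissonIntegral, hsplit]
  rw [integral_sub hsum ha, integral_add (integrable_mul_pt_div ha hz) hanti, integral_conj,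
    cauchyExt_eq_integral, cauchyExt_eq_integral]
  simp [fourierCoeff]

theorem poissonIntegral_eq_cauchyExt {a : Torus → ℂ} (ha : Integrable a ell)
    (hneg : ∀ n : ℤ, n < 0 → fourierCoeff a n = 0) {z : ℂ} (hz : ‖z‖ < 1) :
    poissonIntegral a z = cauchyExt a z := by
  have hconst : HasSum (fun n : ℕ => fourierCoeff (fun t => conj (a t)) n * z ^ n)
      (conj (fourierCoeff a 0)) := by
    convert hasSum_single 0 ?_ using 1
    · simp [fourierCoeff_conj]
    · intro n hn
      rw [fourierCoeff_conj, hneg _ (by omega), map_zero, zero_mul]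
  rw [poissonIntegral_eq_add_conj ha hz, (hasSum_cauchyExt (integrable_conj ha) hz).unique hconst,
    Complex.conj_conj, add_sub_cancel_right]

end CauchyIntegral

section HardyClass

/-- A square integrable function on the circle whose Fourier coefficients of negative index vanish;
its class in `L2T` is a member of `H2`. -/
structure IsHardy (a : Torus → ℂ) : Prop where
  memLp : MemLp a 2 ell
  fourierCoeff_of_neg : ∀ n : ℤ, n < 0 → fourierCoeff a n = 0

variable {a b : Torus → ℂ}

theorem IsHardy.integrable (ha : IsHardy a) : Integrable a ell :=
  ha.memLp.integrable one_le_two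

theorem IsHardy.congr (ha : IsHardy a) (h : a =ᵐ[ell] b) : IsHardy b :=
  ⟨(memLp_congr_ae h).mp ha.memLp, fun n hn => by
    rw [← fourierCoeff_congr_ae h, ha.fourierCoeff_of_neg n hn]⟩

theorem isHardy_of_mem_H2 {g : L2T} (hg : g ∈ H2) : IsHardy g := ⟨Lp.memLp g, hg⟩

theorem IsHardy.toLp_mem_H2 (ha : IsHardy a) : ha.memLp.toLp ∈ H2 := fun n hn => by
  rw [fourierCoeff_congr_ae ha.memLp.coeFn_toLp, ha.fourierCoeff_of_neg n hn]

theorem IsHardy.ae_tendsto_cauchyExt (ha : IsHardy a) :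
    ∀ᵐ t ∂ell, Tendsto (cauchyExt a) (ntFilter t) (𝓝 (a t)) := by
  filter_upwards [ae_tendsto_poissonIntegral ha.integrable] with t ht
  exact tendsto_of_eqOn_ball
    (fun z hz => poissonIntegral_eq_cauchyExt ha.integrable ha.fourierCoeff_of_neg hz) ht

theorem hasSum_integral_mul (ha : MemLp a 2 ell) (hb : MemLp b 2 ell) :
    HasSum (fun k : ℤ => fourierCoeff a (-k) * fourierCoeff b k) (∫ t, a t * b t ∂ell) := by
  have hac : MemLp (fun t => conj (a t)) 2 ell := ha.star
  have hparseval := fourierBasis.hasSum_inner_mul_inner hac.toLp hb.toLp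
  convert! hparseval using 1
  · ext k
    rw [← inner_conj_symm, ← fourierBasis.repr_apply_apply, ← fourierBasis.repr_apply_apply,
      fourierBasis_repr, fourierBasis_repr, fourierCoeff_congr_ae hac.coeFn_toLp,
      fourierCoeff_congr_ae hb.coeFn_toLp, fourierCoeff_conj, Complex.conj_conj]
  · rw [L2.inner_def]
    refine integral_congr_ae ?_
    filter_upwards [hac.coeFn_toLp, hb.coeFn_toLp] with t hat hbt
    rw [hat, hbt, RCLike.inner_apply', Complex.conj_conj]

theorem memLp_fourier_mul (ha : MemLp a 2 ell) (n : ℤ) :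
    MemLp (fun t => fourier n t * a t) 2 ell :=
  ha.of_le ((fourier n).continuous.aestronglyMeasurable.mul ha.aestronglyMeasurable)
    (.of_forall fun t => by rw [norm_mul, norm_fourier_apply, one_mul])

theorem fourierCoeff_fourier_mul (m n : ℤ) (a : Torus → ℂ) :
    fourierCoeff (fun t => fourier m t * a t) n = fourierCoeff a (n - m) := by
  refine integral_congr_ae (.of_forall fun t => ?_)
  simp only [smul_eq_mul]
  rw [← mul_assoc, ← fourier_add, show -n + m = -(n - m) by ring]

theorem hasSum_fourierCoeff_mul (ha : MemLp a 2 ell) (hb : MemLp b 2 ell) (n : ℤ) :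
    HasSum (fun k : ℤ => fourierCoeff a (n - k) * fourierCoeff b k)
      (fourierCoeff (fun t => a t * b t) n) := by
  have h := hasSum_integral_mul (memLp_fourier_mul ha (-n)) hb
  simp only [fourierCoeff_fourier_mul, sub_neg_eq_add, neg_add_eq_sub, mul_assoc] at h
  exact h

theorem IsHardy.fourierCoeff_mul_of_neg (ha : IsHardy a) (hb : IsHardy b) {n : ℤ} (hn : n < 0) :
    fourierCoeff (fun t => a t * b t) n = 0 := by
  refine (hasSum_fourierCoeff_mul ha.memLp hb.memLp n).unique (hasSum_zero.congr_fun fun k => ?_)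
  rcases lt_or_ge k 0 with hk | hk
  · rw [hb.fourierCoeff_of_neg k hk, mul_zero]
  · rw [ha.fourierCoeff_of_neg _ (by omega), zero_mul]

theorem IsHardy.fourierCoeff_mul_natCast (ha : IsHardy a) (hb : IsHardy b) (n : ℕ) :
    fourierCoeff (fun t => a t * b t) n =
      ∑ k ∈ Finset.range (n + 1), fourierCoeff a ((n - k : ℕ) : ℤ) * fourierCoeff b k := by
  refine (hasSum_fourierCoeff_mul ha.memLp hb.memLp n).unique ?_
  have hvanish : ∀ k ∉ (Finset.range (n + 1)).map (Nat.castEmbedding (R := ℤ)),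
      fourierCoeff a (n - k) * fourierCoeff b k = 0 := fun k hk => by
    rcases lt_or_ge k 0 with hk0 | hk0
    · rw [hb.fourierCoeff_of_neg k hk0, mul_zero]
    lift k to ℕ using hk0
    rw [ha.fourierCoeff_of_neg _ ?_, zero_mul]
    have : ¬ k < n + 1 := fun h => hk (Finset.mem_map_of_mem _ (Finset.mem_range.mpr h))
    omega
  have hfinite := hasSum_sum_of_ne_finset_zero (L := .unconditional ℤ) hvanish
  rw [Finset.sum_map] at hfinite
  convert hfinite using 2 with k hk
  rw [Nat.castEmbedding_apply, Nat.cast_sub (Finset.mem_range_succ_iff.mp hk)]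

theorem IsHardy.cauchyExt_mul (ha : IsHardy a) (hb : IsHardy b) {z : ℂ} (hz : ‖z‖ < 1) :
    cauchyExt (fun t => a t * b t) z = cauchyExt a z * cauchyExt b z := by
  have hsum_a := hasSum_cauchyExt ha.integrable hz
  have hsum_b := hasSum_cauchyExt hb.integrable hz
  have hprod := hasSum_sum_range_mul_of_summable_norm hsum_b.summable.norm hsum_a.summable.norm
  rw [hsum_b.tsum_eq, hsum_a.tsum_eq, mul_comm (cauchyExt b z)] at hprod
  have hint : Integrable (fun t => a t * b t) ell := ha.memLp.integrable_mul hb.memLp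
  refine (hasSum_cauchyExt hint hz).unique (hprod.congr_fun fun n => ?_)
  rw [ha.fourierCoeff_mul_natCast hb, Finset.sum_mul]
  refine Finset.sum_congr rfl fun k hk => ?_
  rw [← Nat.add_sub_cancel' (Finset.mem_range_succ_iff.mp hk), pow_add]
  simp only [add_tsub_cancel_left]
  ring

theorem IsHardy.mul_of_bounded (ha : IsHardy a) (hb : IsHardy b) {C : ℝ}
    (hC : ∀ᵐ t ∂ell, ‖b t‖ ≤ C) : IsHardy fun t => a t * b t := by
  refine ⟨ha.memLp.of_le_mul (c := C)
    (ha.memLp.aestronglyMeasurable.mul hb.memLp.aestronglyMeasurable) ?_,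
    fun n hn => ha.fourierCoeff_mul_of_neg hb hn⟩
  filter_upwards [hC] with t ht
  rw [norm_mul, mul_comm]
  gcongr

end HardyClass

section BoundedHolomorphic

theorem fourierCoeff_tsum_mul_pow {a : ℕ → ℂ} (ha : Summable fun n => ‖a n‖) (m : ℕ) :
    fourierCoeff (fun t => ∑' n, a n * pt t ^ n) m = a m := by
  have hcont := continuous_pt
  have hseries := hasSum_integral_of_summable_integral_norm (μ := ell)
    (F := fun (n : ℕ) (t : Torus) => fourier (-(m : ℤ)) t • (a n * pt t ^ n))
    (fun n => (Continuous.integrable_of_hasCompactSupport (by fun_prop)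
      (HasCompactSupport.of_compactSpace _))) (by
      simp_rw [norm_smul, norm_mul, norm_pow, norm_fourier_apply, norm_pt]
      simpa using ha)
  have hterm : ∀ n : ℕ, ∫ t, fourier (-(m : ℤ)) t • (a n * pt t ^ n) ∂ell =
      if n = m then a n else 0 := fun n => by
    simp_rw [← fourier_natCast]
    rw [← fourierCoeff, fourierCoeff.const_mul, fourierCoeff_fourier, Pi.single_apply]
    simp [eq_comm]
  simp_rw [hterm, tsum_const_smul''] at hseries
  refine hseries.unique ((hasSum_ite_eq m (a m)).congr_fun fun n => ?_)
  split_ifs with h <;> simp [h]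

theorem sum_norm_fourierCoeff_sq_le {a : Torus → ℂ} (ha : AEStronglyMeasurable a ell) {C : ℝ}
    (hC : ∀ t, ‖a t‖ ≤ C) (N : ℕ) :
    ∑ n ∈ Finset.range N, ‖fourierCoeff a n‖ ^ 2 ≤ C ^ 2 := by
  have hmem : MemLp a 2 ell := MemLp.of_bound ha C (.of_forall hC)
  have hparseval := hasSum_sq_fourierCoeff hmem.toLp
  rw [fourierCoeff_congr_ae hmem.coeFn_toLp] at hparseval
  calc ∑ n ∈ Finset.range N, ‖fourierCoeff a n‖ ^ 2
      = ∑ n ∈ (Finset.range N).map (Nat.castEmbedding (R := ℤ)), ‖fourierCoeff a n‖ ^ 2 := by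
        simp only [Finset.sum_map, Nat.castEmbedding_apply]
    _ ≤ ∫ t, ‖(hmem.toLp : L2T) t‖ ^ 2 ∂ell :=
        sum_le_hasSum _ (fun _ _ => by positivity) hparseval
    _ ≤ ∫ _, C ^ 2 ∂ell := by
        refine integral_mono_of_nonneg (.of_forall fun t => by positivity) (integrable_const _) ?_
        filter_upwards [hmem.coeFn_toLp] with t ht
        rw [ht]
        exact pow_le_pow_left₀ (norm_nonneg _) (hC t) 2
    _ = C ^ 2 := by simp

variable {c : ℕ → ℂ} {h : ℂ → ℂ} {C : ℝ}

theorem sum_norm_mul_pow_sq_le (hs : ∀ z : ℂ, ‖z‖ < 1 → HasSum (fun n => c n * z ^ n) (h z))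
    (hC : ∀ z : ℂ, ‖z‖ < 1 → ‖h z‖ ≤ C) (N : ℕ) {r : ℝ} (hr0 : 0 ≤ r) (hr1 : r < 1) :
    ∑ n ∈ Finset.range N, ‖c n * r ^ n‖ ^ 2 ≤ C ^ 2 := by
  have hnorm : ∀ t, ‖(r : ℂ) * pt t‖ < 1 := fun t => by
    rwa [norm_mul, norm_pt, mul_one, Complex.norm_real, Real.norm_of_nonneg hr0]
  have hseries : ∀ t, HasSum (fun n => c n * (r : ℂ) ^ n * pt t ^ n) (h (r * pt t)) := fun t => by
    simpa only [mul_pow, mul_assoc] using hs (r * pt t) (hnorm t)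
  have hsummable : Summable fun n => ‖c n * (r : ℂ) ^ n‖ := by
    simpa only [norm_mul, norm_pow, norm_pt, one_pow, mul_one] using (hseries 0).summable.norm
  have hcont : Continuous fun t => ∑' n, c n * (r : ℂ) ^ n * pt t ^ n := by
    refine continuous_tsum (fun n => continuous_const.mul (continuous_pt.pow n)) hsummable
      fun n t => ?_
    rw [norm_mul _ (pt t ^ n), norm_pow (pt t), norm_pt, one_pow, mul_one]
  have hle := sum_norm_fourierCoeff_sq_le hcont.aestronglyMeasurable
    (fun t => by rw [(hseries t).tsum_eq]; exact hC _ (hnorm t)) N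
  simpa only [fourierCoeff_tsum_mul_pow hsummable] using hle

theorem sum_norm_sq_le_of_norm_le (hs : ∀ z : ℂ, ‖z‖ < 1 → HasSum (fun n => c n * z ^ n) (h z))
    (hC : ∀ z : ℂ, ‖z‖ < 1 → ‖h z‖ ≤ C) (N : ℕ) :
    ∑ n ∈ Finset.range N, ‖c n‖ ^ 2 ≤ C ^ 2 := by
  have hcont : Continuous fun r : ℝ => ∑ n ∈ Finset.range N, ‖c n * (r : ℂ) ^ n‖ ^ 2 := by fun_prop
  have hlim : Tendsto (fun r : ℝ => ∑ n ∈ Finset.range N, ‖c n * (r : ℂ) ^ n‖ ^ 2) (𝓝[<] 1)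
      (𝓝 (∑ n ∈ Finset.range N, ‖c n‖ ^ 2)) :=
    (hcont.tendsto' 1 _ (by simp)).mono_left nhdsWithin_le_nhds
  refine le_of_tendsto hlim ?_
  filter_upwards [Ioo_mem_nhdsLT one_pos] with r hr
  exact sum_norm_mul_pow_sq_le hs hC N hr.1.le hr.2

theorem exists_isHardy_of_summable_sq (hc : Summable fun n => ‖c n‖ ^ 2) :
    ∃ a : Torus → ℂ, IsHardy a ∧ ∀ n : ℕ, fourierCoeff a n = c n := by
  have hinj : Function.Injective ((↑) : ℕ → ℤ) := Nat.cast_injective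
  set d : ℤ → ℂ := Function.extend (↑) c 0
  have hd_neg : ∀ n : ℤ, n < 0 → d n = 0 := fun n hn =>
    Function.extend_apply' _ _ _ fun ⟨_, _⟩ => by omega
  have hsum : Summable fun n : ℤ => ‖d n‖ ^ 2 := by
    rw [← hinj.summable_iff]
    · simpa only [Function.comp_def, d, hinj.extend_apply] using hc
    · intro n hn
      simp [d, Function.extend_apply' _ _ _ hn]
  have hmem : Memℓp d 2 := by
    rw [memℓp_gen_iff (by norm_num)]
    simpa using hsum
  set g : L2T := fourierBasis.repr.symm (⟨d, hmem⟩ : lp (fun _ : ℤ => ℂ) 2)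
  have hcoeff : ∀ n, fourierCoeff g n = d n := fun n => by
    rw [← fourierBasis_repr, LinearIsometryEquiv.apply_symm_apply]
  exact ⟨g, ⟨Lp.memLp g, fun n hn => (hcoeff n).trans (hd_neg n hn)⟩, fun n =>
    (hcoeff n).trans (hinj.extend_apply _ _ _)⟩

theorem exists_isHardy_of_norm_le (hd : DifferentiableOn ℂ h (Metric.ball 0 1))
    (hC : ∀ z : ℂ, ‖z‖ < 1 → ‖h z‖ ≤ C) :
    ∃ a, IsHardy a ∧ ∀ z : ℂ, ‖z‖ < 1 → cauchyExt a z = h z := by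
  have htaylor : ∀ z : ℂ, ‖z‖ < 1 →
      HasSum (fun n : ℕ => (n.factorial : ℂ)⁻¹ * iteratedDeriv n h 0 * z ^ n) (h z) :=
    fun z hz => by
      convert! Complex.hasSum_taylorSeries_on_ball hd (mem_ball_zero_iff.mpr hz) using 1
      ext n
      simp only [smul_eq_mul, sub_zero]
      ring
  obtain ⟨a, ha, hcoeff⟩ := exists_isHardy_of_summable_sq
    (summable_of_sum_range_le (fun _ => by positivity) (sum_norm_sq_le_of_norm_le htaylor hC))
  refine ⟨a, ha, fun z hz => ?_⟩
  have hcauchy := hasSum_cauchyExt ha.integrable hz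
  simp_rw [hcoeff] at hcauchy
  exact hcauchy.unique (htaylor z hz)

theorem bdry_eq_of_tendsto {F : ℂ → ℂ} {t : Torus} {c : ℂ} (hF : Tendsto F (ntFilter t) (𝓝 c)) :
    bdry F t = c :=
  hF.limUnder_eq

theorem ae_eq_bdry_of_cauchyExt_eq {a : Torus → ℂ} (ha : IsHardy a)
    (hah : ∀ z : ℂ, ‖z‖ < 1 → cauchyExt a z = h z) : a =ᵐ[ell] bdry h := by
  filter_upwards [ha.ae_tendsto_cauchyExt] with t ht
  exact (bdry_eq_of_tendsto (tendsto_of_eqOn_ball hah ht)).symm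

theorem isHardy_bdry (hd : DifferentiableOn ℂ h (Metric.ball 0 1))
    (hC : ∀ z : ℂ, ‖z‖ < 1 → ‖h z‖ ≤ C) : IsHardy (bdry h) := by
  obtain ⟨a, ha, hah⟩ := exists_isHardy_of_norm_le hd hC
  exact ha.congr (ae_eq_bdry_of_cauchyExt_eq ha hah)

theorem cauchyExt_congr_ae {a b : Torus → ℂ} (hab : a =ᵐ[ell] b) (z : ℂ) :
    cauchyExt a z = cauchyExt b z := by
  rw [cauchyExt_eq_integral, cauchyExt_eq_integral]
  refine integral_congr_ae ?_
  filter_upwards [hab] with t ht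
  rw [ht]

theorem cauchyExt_bdry (hd : DifferentiableOn ℂ h (Metric.ball 0 1))
    (hC : ∀ z : ℂ, ‖z‖ < 1 → ‖h z‖ ≤ C) {z : ℂ} (hz : ‖z‖ < 1) : cauchyExt (bdry h) z = h z := by
  obtain ⟨a, ha, hah⟩ := exists_isHardy_of_norm_le hd hC
  rw [← cauchyExt_congr_ae (ae_eq_bdry_of_cauchyExt_eq ha hah), hah z hz]

theorem ae_tendsto_bdry (hd : DifferentiableOn ℂ h (Metric.ball 0 1))
    (hC : ∀ z : ℂ, ‖z‖ < 1 → ‖h z‖ ≤ C) :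
    ∀ᵐ t ∂ell, Tendsto h (ntFilter t) (𝓝 (bdry h t)) :=
  (isHardy_bdry hd hC).ae_tendsto_cauchyExt.mono fun _ ht =>
    tendsto_of_eqOn_ball (fun _ => cauchyExt_bdry hd hC) ht

end BoundedHolomorphic

section OuterFunction

/-- The Herglotz integral of a real function on the circle; `outer ρ` is the exponential of that of
`log ρ`. -/
noncomputable def herglotz (φ : Torus → ℝ) (z : ℂ) : ℂ :=
  ∫ t, (pt t + z) / (pt t - z) * (φ t : ℂ) ∂ell

theorem integrable_herglotz {φ : Torus → ℝ} (hφ : Integrable φ ell) {z : ℂ} (hz : ‖z‖ < 1) :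
    Integrable (fun t => (pt t + z) / (pt t - z) * (φ t : ℂ)) ell := by
  have hkernel : Continuous fun t => (pt t + z) / (pt t - z) :=
    (continuous_pt.add continuous_const).div (continuous_pt.sub continuous_const)
      (pt_sub_ne_zero hz)
  have hφ' : Integrable (fun t => (φ t : ℂ)) ell := hφ.ofReal
  rw [← integrableOn_univ] at hφ' ⊢
  exact hφ'.continuousOn_mul hkernel.continuousOn isCompact_univ

theorem herglotz_add {φ ψ : Torus → ℝ} (hφ : Integrable φ ell) (hψ : Integrable ψ ell) {z : ℂ}
    (hz : ‖z‖ < 1) : herglotz (fun t => φ t + ψ t) z = herglotz φ z + herglotz ψ z := by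
  rw [herglotz, herglotz, herglotz,
    ← integral_add (integrable_herglotz hφ hz) (integrable_herglotz hψ hz)]
  simp only [Complex.ofReal_add, mul_add]

theorem herglotz_neg (φ : Torus → ℝ) (z : ℂ) : herglotz (fun t => -φ t) z = -herglotz φ z := by
  simp only [herglotz, Complex.ofReal_neg, mul_neg, integral_neg]

theorem herglotz_eq_cauchyExt {φ : Torus → ℝ} (hφ : Integrable φ ell) {z : ℂ} (hz : ‖z‖ < 1) :
    herglotz φ z = 2 * cauchyExt (fun t => (φ t : ℂ)) z - ∫ t, (φ t : ℂ) ∂ell := by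
  have hφ' : Integrable (fun t => (φ t : ℂ)) ell := hφ.ofReal
  rw [cauchyExt_eq_integral, ← integral_const_mul,
    ← integral_sub ((integrable_mul_pt_div hφ' hz).const_mul 2) hφ']
  refine integral_congr_ae (.of_forall fun t => ?_)
  have := pt_sub_ne_zero hz t
  field_simp
  ring

theorem differentiableOn_herglotz {φ : Torus → ℝ} (hφ : Integrable φ ell) :
    DifferentiableOn ℂ (herglotz φ) (Metric.ball 0 1) :=
  (((differentiableOn_cauchyExt hφ.ofReal).const_mul 2).sub_const _).congr fun _ hz =>
    herglotz_eq_cauchyExt hφ (mem_ball_zero_iff.mp hz)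

theorem re_herglotz {φ : Torus → ℝ} (hφ : Integrable φ ell) {z : ℂ} (hz : ‖z‖ < 1) :
    (herglotz φ z).re = poissonIntegral φ z := by
  have hre := integral_re (integrable_herglotz hφ hz)
  simp only [RCLike.re_to_complex] at hre
  rw [herglotz, ← hre, poissonIntegral]
  refine integral_congr_ae (.of_forall fun t => ?_)
  have hkernel := congrFun (poissonKernel_eq_re_herglotzRieszKernel (c := 0) (w := z)) (pt t)
  simp only [Complex.re_mul_ofReal, smul_eq_mul, hkernel, Function.comp_apply,
    herglotzRieszKernel, sub_zero]

theorem herglotz_zero_right (φ : Torus → ℝ) : herglotz φ 0 = (∫ t, φ t ∂ell : ℝ) := by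
  rw [herglotz, ← integral_complex_ofReal]
  refine integral_congr_ae (.of_forall fun t => ?_)
  have := pt_sub_ne_zero (z := 0) (by simp) t
  simp only [add_zero, sub_zero] at this ⊢
  rw [div_self this, one_mul]

/-- An admissible boundary modulus of an outer function: positive a.e., with integrable
logarithm. -/
structure LogIntegrable (ρ : Torus → ℝ) : Prop where
  pos : ∀ᵐ t ∂ell, 0 < ρ t
  integrable_log : Integrable (fun t => Real.log (ρ t)) ell

variable {ρ σ : Torus → ℝ}

theorem LogIntegrable.mul (hρ : LogIntegrable ρ) (hσ : LogIntegrable σ) :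
    LogIntegrable (ρ * σ) where
  pos := by filter_upwards [hρ.pos, hσ.pos] with t h₁ h₂ using mul_pos h₁ h₂
  integrable_log := (hρ.integrable_log.add hσ.integrable_log).congr (by
    filter_upwards [hρ.pos, hσ.pos] with t h₁ h₂ using (Real.log_mul h₁.ne' h₂.ne').symm)

theorem LogIntegrable.inv (hρ : LogIntegrable ρ) : LogIntegrable ρ⁻¹ where
  pos := hρ.pos.mono fun _ ht => inv_pos.mpr ht
  integrable_log := hρ.integrable_log.neg.congr
    (.of_forall fun t => by simp [Real.log_inv])

theorem outer_eq_exp_herglotz (ρ : Torus → ℝ) (z : ℂ) :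
    outer ρ z = Complex.exp (herglotz (fun t => Real.log (ρ t)) z) := rfl

theorem outer_ne_zero (ρ : Torus → ℝ) (z : ℂ) : outer ρ z ≠ 0 := Complex.exp_ne_zero _

theorem outer_mul (hρ : LogIntegrable ρ) (hσ : LogIntegrable σ) {z : ℂ} (hz : ‖z‖ < 1) :
    outer (ρ * σ) z = outer ρ z * outer σ z := by
  have hlog : (fun t => Real.log ((ρ * σ) t)) =ᵐ[ell]
      fun t => Real.log (ρ t) + Real.log (σ t) := by
    filter_upwards [hρ.pos, hσ.pos] with t h₁ h₂ using Real.log_mul h₁.ne' h₂.ne'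
  simp only [outer_eq_exp_herglotz]
  rw [← Complex.exp_add, ← herglotz_add hρ.integrable_log hσ.integrable_log hz]
  congr 1
  refine integral_congr_ae ?_
  filter_upwards [hlog] with t ht
  rw [ht]

theorem outer_inv (ρ : Torus → ℝ) (z : ℂ) : outer ρ⁻¹ z = (outer ρ z)⁻¹ := by
  simp only [outer_eq_exp_herglotz, Pi.inv_apply, Real.log_inv, herglotz_neg, Complex.exp_neg]

theorem outer_zero_right (ρ : Torus → ℝ) :
    outer ρ 0 = (Real.exp (∫ t, Real.log (ρ t) ∂ell) : ℝ) := by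
  rw [outer_eq_exp_herglotz, herglotz_zero_right, Complex.ofReal_exp]

theorem LogIntegrable.differentiableOn_outer (hρ : LogIntegrable ρ) :
    DifferentiableOn ℂ (outer ρ) (Metric.ball 0 1) :=
  (differentiableOn_herglotz hρ.integrable_log).cexp

theorem LogIntegrable.norm_outer (hρ : LogIntegrable ρ) {z : ℂ} (hz : ‖z‖ < 1) :
    ‖outer ρ z‖ = Real.exp (poissonIntegral (fun t => Real.log (ρ t)) z) := by
  rw [outer_eq_exp_herglotz, Complex.norm_exp, re_herglotz hρ.integrable_log hz]

theorem LogIntegrable.ae_tendsto_norm_outer (hρ : LogIntegrable ρ) :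
    ∀ᵐ t ∂ell, Tendsto (fun z => ‖outer ρ z‖) (ntFilter t) (𝓝 (ρ t)) := by
  filter_upwards [ae_tendsto_poissonIntegral hρ.integrable_log, hρ.pos] with t ht hpos
  have hexp := (Real.continuous_exp.tendsto _).comp ht
  rw [Real.exp_log hpos] at hexp
  exact hexp.congr' ((eventually_norm_lt_one_ntFilter t).mono fun z hz => (hρ.norm_outer hz).symm)

section Bounded

variable {C : ℝ}

theorem LogIntegrable.norm_outer_le (hρ : LogIntegrable ρ) (hC : ∀ᵐ t ∂ell, ρ t ≤ C) {z : ℂ}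
    (hz : ‖z‖ < 1) : ‖outer ρ z‖ ≤ C := by
  obtain ⟨t, htpos, htC⟩ := (hρ.pos.and hC).exists
  have hlog : (fun t => Real.log (ρ t)) ≤ᵐ[ell] fun _ => Real.log C := by
    filter_upwards [hρ.pos, hC] with t using Real.log_le_log
  calc ‖outer ρ z‖ = Real.exp (poissonIntegral (fun t => Real.log (ρ t)) z) := hρ.norm_outer hz
    _ ≤ Real.exp (Real.log C) := by
      rw [← poissonIntegral_const (Real.log C) hz]
      gcongr
      exact poissonIntegral_mono hρ.integrable_log (integrable_const _) hlog hz
    _ = C := Real.exp_log (htpos.trans_le htC)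

theorem LogIntegrable.isHardy_bdry_outer (hρ : LogIntegrable ρ) (hC : ∀ᵐ t ∂ell, ρ t ≤ C) :
    IsHardy (bdry (outer ρ)) :=
  isHardy_bdry hρ.differentiableOn_outer fun _ => hρ.norm_outer_le hC

theorem LogIntegrable.cauchyExt_bdry_outer (hρ : LogIntegrable ρ) (hC : ∀ᵐ t ∂ell, ρ t ≤ C)
    {z : ℂ} (hz : ‖z‖ < 1) : cauchyExt (bdry (outer ρ)) z = outer ρ z :=
  cauchyExt_bdry hρ.differentiableOn_outer (fun _ => hρ.norm_outer_le hC) hz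

theorem LogIntegrable.ae_tendsto_bdry_outer_of_le (hρ : LogIntegrable ρ)
    (hC : ∀ᵐ t ∂ell, ρ t ≤ C) :
    ∀ᵐ t ∂ell, Tendsto (outer ρ) (ntFilter t) (𝓝 (bdry (outer ρ) t)) :=
  ae_tendsto_bdry hρ.differentiableOn_outer fun _ => hρ.norm_outer_le hC

theorem LogIntegrable.integral_bdry_outer (hρ : LogIntegrable ρ) (hC : ∀ᵐ t ∂ell, ρ t ≤ C) :
    ∫ t, bdry (outer ρ) t ∂ell = (Real.exp (∫ t, Real.log (ρ t) ∂ell) : ℝ) := by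
  have hmean := hρ.cauchyExt_bdry_outer hC (z := 0) (by simp)
  rw [outer_zero_right, cauchyExt_eq_integral] at hmean
  rw [← hmean]
  refine integral_congr_ae (.of_forall fun t => ?_)
  have := pt_sub_ne_zero (z := 0) (by simp) t
  simp only [sub_zero] at this ⊢
  rw [div_self this, mul_one]

end Bounded

/-- The truncated moduli `min 1 ((n + 1) ρ)`, which increase to `1`. Both `cutoff ρ n` and
`ρ⁻¹ * cutoff ρ n` are bounded, so that every outer function is a quotient of bounded ones. -/
noncomputable def cutoff (ρ : Torus → ℝ) (n : ℕ) (t : Torus) : ℝ := min 1 ((n + 1) * ρ t)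

theorem cutoff_le_one (ρ : Torus → ℝ) (n : ℕ) (t : Torus) : cutoff ρ n t ≤ 1 := min_le_left _ _

theorem cutoff_pos {n : ℕ} {t : Torus} (ht : 0 < ρ t) : 0 < cutoff ρ n t :=
  lt_min one_pos (by positivity)

theorem log_cutoff (n : ℕ) {t : Torus} (ht : 0 < ρ t) :
    Real.log (cutoff ρ n t) = min 0 (Real.log (n + 1) + Real.log (ρ t)) := by
  have hn : (0 : ℝ) < n + 1 := by positivity
  rw [← Real.log_mul hn.ne' ht.ne', ← Real.log_one]
  exact Real.strictMonoOn_log.monotoneOn.map_inf (Set.mem_Ioi.mpr one_pos)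
    (Set.mem_Ioi.mpr (by positivity))

theorem LogIntegrable.logIntegrable_cutoff (hρ : LogIntegrable ρ) (n : ℕ) :
    LogIntegrable (cutoff ρ n) where
  pos := hρ.pos.mono fun _ => cutoff_pos
  integrable_log := ((integrable_const (0 : ℝ)).inf
    ((integrable_const (Real.log (n + 1))).add hρ.integrable_log)).congr
      (hρ.pos.mono fun _ ht => (log_cutoff n ht).symm)

theorem LogIntegrable.inv_mul_cutoff_le (hρ : LogIntegrable ρ) (n : ℕ) :
    ∀ᵐ t ∂ell, (ρ⁻¹ * cutoff ρ n) t ≤ n + 1 := by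
  filter_upwards [hρ.pos] with t ht
  rw [Pi.mul_apply, Pi.inv_apply, inv_mul_le_iff₀ ht, mul_comm (ρ t)]
  exact min_le_right _ _

theorem LogIntegrable.outer_eq_div (hρ : LogIntegrable ρ) (n : ℕ) {z : ℂ} (hz : ‖z‖ < 1) :
    outer (cutoff ρ n) z / outer (ρ⁻¹ * cutoff ρ n) z = outer ρ z := by
  rw [outer_mul hρ.inv (hρ.logIntegrable_cutoff n) hz, outer_inv]
  have := outer_ne_zero (cutoff ρ n) z
  have := outer_ne_zero ρ z
  field_simp

theorem LogIntegrable.ae_tendsto_bdry_outer (hρ : LogIntegrable ρ) :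
    ∀ᵐ t ∂ell, Tendsto (outer ρ) (ntFilter t) (𝓝 (bdry (outer ρ) t)) := by
  have hquot := hρ.inv.mul (hρ.logIntegrable_cutoff 0)
  filter_upwards [
    (hρ.logIntegrable_cutoff 0).ae_tendsto_bdry_outer_of_le (.of_forall (cutoff_le_one ρ 0)),
    hquot.ae_tendsto_bdry_outer_of_le (hρ.inv_mul_cutoff_le 0), hquot.ae_tendsto_norm_outer,
    hquot.pos] with t hnum hden hnorm hpos
  have hne : bdry (outer (ρ⁻¹ * cutoff ρ 0)) t ≠ 0 := norm_pos_iff.mp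
    (tendsto_nhds_unique hden.norm hnorm ▸ hpos)
  have hlim := tendsto_of_eqOn_ball (fun _ hz => hρ.outer_eq_div 0 hz) (hnum.div hden hne)
  rwa [bdry_eq_of_tendsto hlim]

theorem LogIntegrable.norm_bdry_outer (hρ : LogIntegrable ρ) :
    ∀ᵐ t ∂ell, ‖bdry (outer ρ) t‖ = ρ t := by
  filter_upwards [hρ.ae_tendsto_bdry_outer, hρ.ae_tendsto_norm_outer] with t h₁ h₂
  exact tendsto_nhds_unique h₁.norm h₂

theorem LogIntegrable.bdry_outer_ne_zero (hρ : LogIntegrable ρ) :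
    ∀ᵐ t ∂ell, bdry (outer ρ) t ≠ 0 := by
  filter_upwards [hρ.norm_bdry_outer, hρ.pos] with t h₁ h₂
  exact norm_pos_iff.mp (h₁ ▸ h₂)

theorem bdry_outer_mul (hρ : LogIntegrable ρ) (hσ : LogIntegrable σ) :
    ∀ᵐ t ∂ell, bdry (outer (ρ * σ)) t = bdry (outer ρ) t * bdry (outer σ) t := by
  filter_upwards [hρ.ae_tendsto_bdry_outer, hσ.ae_tendsto_bdry_outer] with t h₁ h₂
  exact bdry_eq_of_tendsto
    (tendsto_of_eqOn_ball (fun _ hz => (outer_mul hρ hσ hz).symm) (h₁.mul h₂))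

theorem LogIntegrable.bdry_outer_inv (hρ : LogIntegrable ρ) :
    ∀ᵐ t ∂ell, bdry (outer ρ⁻¹) t = (bdry (outer ρ) t)⁻¹ := by
  filter_upwards [hρ.ae_tendsto_bdry_outer, hρ.bdry_outer_ne_zero] with t hlim hne
  exact bdry_eq_of_tendsto ((hlim.inv₀ hne).congr fun z => (outer_inv ρ z).symm)

theorem LogIntegrable.aestronglyMeasurable_bdry_outer (hρ : LogIntegrable ρ) :
    AEStronglyMeasurable (bdry (outer ρ)) ell := by
  have hquot := hρ.inv.mul (hρ.logIntegrable_cutoff 0)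
  have hnum := (hρ.logIntegrable_cutoff 0).isHardy_bdry_outer (.of_forall (cutoff_le_one ρ 0))
  have hden := hquot.isHardy_bdry_outer (hρ.inv_mul_cutoff_le 0)
  refine (hnum.memLp.aestronglyMeasurable.div₀ hden.memLp.aestronglyMeasurable).congr ?_
  filter_upwards [bdry_outer_mul hρ.inv (hρ.logIntegrable_cutoff 0), hρ.bdry_outer_inv,
    hρ.bdry_outer_ne_zero, (hρ.logIntegrable_cutoff 0).bdry_outer_ne_zero] with t hmul hinv hne hcut
  rw [Pi.div_apply, hmul, hinv]
  field_simp

end OuterFunction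

section Cutoff

variable {ρ : Torus → ℝ}

theorem integral_norm_bdry_outer_sub_one_sq_le (hρ : LogIntegrable ρ) (h1 : ∀ᵐ t ∂ell, ρ t ≤ 1) :
    ∫ t, ‖bdry (outer ρ) t - 1‖ ^ 2 ∂ell ≤ 2 - 2 * Real.exp (∫ t, Real.log (ρ t) ∂ell) := by
  have hint := (hρ.isHardy_bdry_outer h1).integrable
  have hint_re : Integrable (fun t => (bdry (outer ρ) t).re) ell := hint.re
  have hmean : ∫ t, (bdry (outer ρ) t).re ∂ell = Real.exp (∫ t, Real.log (ρ t) ∂ell) := by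
    have hre := integral_re hint
    simp only [RCLike.re_to_complex] at hre
    rw [hre, hρ.integral_bdry_outer h1, Complex.ofReal_re]
  calc ∫ t, ‖bdry (outer ρ) t - 1‖ ^ 2 ∂ell ≤ ∫ t, (2 - 2 * (bdry (outer ρ) t).re) ∂ell := by
        refine integral_mono_of_nonneg (.of_forall fun t => by positivity)
          ((integrable_const _).sub (hint_re.const_mul 2)) ?_
        filter_upwards [h1, hρ.norm_bdry_outer] with t hle hnorm
        have hsq : ‖bdry (outer ρ) t‖ ^ 2 ≤ 1 := pow_le_one₀ (norm_nonneg _) (hnorm.trans_le hle)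
        rw [← Complex.normSq_eq_norm_sq, Complex.normSq_apply] at hsq ⊢
        simp only [Complex.sub_re, Complex.sub_im, Complex.one_re, Complex.one_im]
        nlinarith
    _ = _ := by
        rw [integral_sub (integrable_const _) (hint_re.const_mul 2), integral_const_mul, hmean]
        simp

theorem abs_log_cutoff_le (n : ℕ) {t : Torus} (ht : 0 < ρ t) :
    |Real.log (cutoff ρ n t)| ≤ |Real.log (ρ t)| := by
  have hn : 0 ≤ Real.log (n + 1) := Real.log_nonneg (by linarith [n.cast_nonneg (α := ℝ)])
  rw [log_cutoff n ht, abs_of_nonpos (min_le_left _ _), neg_le]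
  exact le_min (neg_nonpos.mpr (abs_nonneg _))
    ((neg_abs_le _).trans (le_add_of_nonneg_left hn))

theorem tendsto_cutoff {t : Torus} (ht : 0 < ρ t) :
    Tendsto (fun n => cutoff ρ n t) atTop (𝓝 1) := by
  have hlarge : Tendsto (fun n : ℕ => ((n : ℝ) + 1) * ρ t) atTop atTop :=
    (tendsto_atTop_add_const_right _ 1 tendsto_natCast_atTop_atTop).atTop_mul_const ht
  refine tendsto_const_nhds.congr' ?_
  filter_upwards [hlarge.eventually_ge_atTop 1] with n hn
  exact (min_eq_left hn).symm

theorem LogIntegrable.tendsto_integral_log_cutoff (hρ : LogIntegrable ρ) :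
    Tendsto (fun n => ∫ t, Real.log (cutoff ρ n t) ∂ell) atTop (𝓝 0) := by
  rw [← integral_zero Torus ℝ (μ := ell)]
  refine tendsto_integral_of_dominated_convergence (fun t => |Real.log (ρ t)|)
    (fun n => (hρ.logIntegrable_cutoff n).integrable_log.aestronglyMeasurable)
    hρ.integrable_log.abs (fun n => hρ.pos.mono fun t => abs_log_cutoff_le n)
    (hρ.pos.mono fun t ht => ?_)
  have hlog := (Real.continuousAt_log one_ne_zero).tendsto.comp (tendsto_cutoff ht)
  rwa [Real.log_one] at hlog

theorem eLpNorm_two_eq_sqrt {α E : Type*} [MeasurableSpace α] [NormedAddCommGroup E]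
    {ν : Measure α} {a : α → E} (ha : MemLp a 2 ν) :
    eLpNorm a 2 ν = ENNReal.ofReal (√(∫ t, ‖a t‖ ^ 2 ∂ν)) := by
  rw [ha.eLpNorm_eq_integral_rpow_norm two_ne_zero ENNReal.ofNat_ne_top, Real.sqrt_eq_rpow]
  norm_num

theorem LogIntegrable.tendsto_integral_norm_bdry_outer_cutoff_sub_one_sq (hρ : LogIntegrable ρ) :
    Tendsto (fun n => ∫ t, ‖bdry (outer (cutoff ρ n)) t - 1‖ ^ 2 ∂ell) atTop (𝓝 0) := by
  have hexp := (Real.continuous_exp.tendsto _).comp hρ.tendsto_integral_log_cutoff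
  refine squeeze_zero (fun n => integral_nonneg fun t => by positivity)
    (fun n => integral_norm_bdry_outer_sub_one_sq_le (hρ.logIntegrable_cutoff n)
      (.of_forall (cutoff_le_one ρ n))) ?_
  simpa using (hexp.const_mul 2).const_sub 2

theorem LogIntegrable.isHardy_bdry_outer_cutoff (hρ : LogIntegrable ρ) (n : ℕ) :
    IsHardy (bdry (outer (cutoff ρ n))) :=
  (hρ.logIntegrable_cutoff n).isHardy_bdry_outer (.of_forall (cutoff_le_one ρ n))

theorem LogIntegrable.norm_bdry_outer_cutoff_le_one (hρ : LogIntegrable ρ) (n : ℕ) :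
    ∀ᵐ t ∂ell, ‖bdry (outer (cutoff ρ n)) t‖ ≤ 1 :=
  (hρ.logIntegrable_cutoff n).norm_bdry_outer.mono fun t ht => ht.trans_le (cutoff_le_one ρ n t)

theorem LogIntegrable.exists_seq_tendsto_bdry_outer_cutoff (hρ : LogIntegrable ρ) :
    ∃ ns : ℕ → ℕ, ∀ᵐ t ∂ell,
      Tendsto (fun j => bdry (outer (cutoff ρ (ns j))) t) atTop (𝓝 1) := by
  have hmeasure : TendstoInMeasure ell (fun n => bdry (outer (cutoff ρ n))) atTop fun _ => 1 := by
    refine tendstoInMeasure_of_tendsto_eLpNorm two_ne_zero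
      (fun n => (hρ.isHardy_bdry_outer_cutoff n).memLp.aestronglyMeasurable)
      aestronglyMeasurable_const ?_
    simp_rw [eLpNorm_two_eq_sqrt ((hρ.isHardy_bdry_outer_cutoff _).memLp.sub (memLp_const 1))]
    simpa using ENNReal.tendsto_ofReal
      ((Real.continuous_sqrt.tendsto _).comp
        hρ.tendsto_integral_norm_bdry_outer_cutoff_sub_one_sq)
  obtain ⟨ns, -, hns⟩ := hmeasure.exists_seq_tendsto_ae
  exact ⟨ns, hns⟩

theorem LogIntegrable.isHardy_bdry_outer_inv_mul_cutoff (hρ : LogIntegrable ρ) (n : ℕ) :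
    IsHardy (bdry (outer (ρ⁻¹ * cutoff ρ n))) :=
  (hρ.inv.mul (hρ.logIntegrable_cutoff n)).isHardy_bdry_outer (hρ.inv_mul_cutoff_le n)

theorem LogIntegrable.norm_bdry_outer_inv_mul_cutoff_le (hρ : LogIntegrable ρ) (n : ℕ) :
    ∀ᵐ t ∂ell, ‖bdry (outer (ρ⁻¹ * cutoff ρ n)) t‖ ≤ n + 1 := by
  filter_upwards [(hρ.inv.mul (hρ.logIntegrable_cutoff n)).norm_bdry_outer,
    hρ.inv_mul_cutoff_le n] with t hnorm hle using hnorm.trans_le hle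

theorem LogIntegrable.bdry_outer_mul_bdry_outer_inv_mul_cutoff (hρ : LogIntegrable ρ) (n : ℕ) :
    ∀ᵐ t ∂ell, bdry (outer ρ) t * bdry (outer (ρ⁻¹ * cutoff ρ n)) t =
      bdry (outer (cutoff ρ n)) t := by
  filter_upwards [bdry_outer_mul hρ.inv (hρ.logIntegrable_cutoff n), hρ.bdry_outer_inv,
    hρ.bdry_outer_ne_zero] with t hmul hinv hne
  rw [hmul, hinv, mul_inv_cancel_left₀ hne]

end Cutoff

section HardyMulOuter

variable {ρ : Torus → ℝ} {g v : Torus → ℂ}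

theorem isHardy_of_tendsto_mul (hg : MemLp g 2 ell) {p : ℕ → Torus → ℂ}
    (hp : ∀ j, AEStronglyMeasurable (p j) ell) (hp_le : ∀ j, ∀ᵐ t ∂ell, ‖p j t‖ ≤ 1)
    (hp_lim : ∀ᵐ t ∂ell, Tendsto (fun j => p j t) atTop (𝓝 1))
    (hgp : ∀ j, ∀ n : ℤ, n < 0 → fourierCoeff (fun t => g t * p j t) n = 0) : IsHardy g := by
  refine ⟨hg, fun n hn => ?_⟩
  have hlim : Tendsto (fun j => fourierCoeff (fun t => g t * p j t) n) atTop
      (𝓝 (fourierCoeff g n)) := by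
    refine tendsto_integral_of_dominated_convergence (fun t => ‖g t‖)
      (fun j => (fourier (-n)).continuous.aestronglyMeasurable.smul
        (hg.aestronglyMeasurable.mul (hp j))) (hg.integrable one_le_two).norm (fun j => ?_) ?_
    · filter_upwards [hp_le j] with t ht
      rw [norm_smul, norm_fourier_apply, one_mul, norm_mul]
      exact mul_le_of_le_one_right (norm_nonneg _) ht
    · filter_upwards [hp_lim] with t ht
      simpa only [mul_one] using (ht.const_mul (g t)).const_smul (fourier (-n) t)
  refine tendsto_nhds_unique hlim (tendsto_const_nhds.congr fun j => (hgp j n hn).symm)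

theorem tendsto_integral_norm_sub_mul_sq (hv : MemLp v 2 ell) {p : ℕ → Torus → ℂ}
    (hp : ∀ j, AEStronglyMeasurable (p j) ell) (hp_le : ∀ j, ∀ᵐ t ∂ell, ‖p j t‖ ≤ 1)
    (hp_lim : ∀ᵐ t ∂ell, Tendsto (fun j => p j t) atTop (𝓝 1)) :
    Tendsto (fun j => ∫ t, ‖v t - v t * p j t‖ ^ 2 ∂ell) atTop (𝓝 0) := by
  have hmeas : ∀ j, AEStronglyMeasurable (fun t => ‖v t - v t * p j t‖ ^ 2) ell := fun j =>
    (hv.aestronglyMeasurable.sub (hv.aestronglyMeasurable.mul (hp j))).norm.pow 2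
  have hbound : ∀ j, ∀ᵐ t ∂ell, ‖‖v t - v t * p j t‖ ^ 2‖ ≤ 4 * ‖v t‖ ^ 2 := fun j => by
    filter_upwards [hp_le j] with t ht
    have hle : ‖v t * p j t‖ ≤ ‖v t‖ := by
      rw [norm_mul]
      exact mul_le_of_le_one_right (norm_nonneg _) ht
    have hsub : ‖v t - v t * p j t‖ ≤ 2 * ‖v t‖ := by linarith [norm_sub_le (v t) (v t * p j t)]
    rw [norm_pow, norm_norm]
    calc ‖v t - v t * p j t‖ ^ 2 ≤ (2 * ‖v t‖) ^ 2 := by gcongr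
      _ = 4 * ‖v t‖ ^ 2 := by ring
  have hlim : ∀ᵐ t ∂ell, Tendsto (fun j => ‖v t - v t * p j t‖ ^ 2) atTop (𝓝 0) := by
    filter_upwards [hp_lim] with t ht
    simpa using ((ht.const_mul (v t)).const_sub (v t)).norm.pow 2
  rw [← integral_zero Torus ℝ (μ := ell)]
  exact tendsto_integral_of_dominated_convergence _ hmeas
    ((hv.integrable_norm_pow two_ne_zero).const_mul 4) hbound hlim

theorem IsHardy.mul_bdry_outer (hg : IsHardy g) (hρ : LogIntegrable ρ)
    (hgw : MemLp (fun t => g t * bdry (outer ρ) t) 2 ell) :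
    IsHardy fun t => g t * bdry (outer ρ) t := by
  obtain ⟨ns, hns⟩ := hρ.inv.exists_seq_tendsto_bdry_outer_cutoff
  refine isHardy_of_tendsto_mul hgw
    (fun j => (hρ.inv.isHardy_bdry_outer_cutoff (ns j)).memLp.aestronglyMeasurable)
    (fun j => hρ.inv.norm_bdry_outer_cutoff_le_one (ns j)) hns fun j n hn => ?_
  rw [← hg.fourierCoeff_mul_of_neg (hρ.inv.isHardy_bdry_outer_inv_mul_cutoff (ns j)) hn]
  refine congrFun (fourierCoeff_congr_ae ?_) n
  filter_upwards [hρ.inv.bdry_outer_mul_bdry_outer_inv_mul_cutoff (ns j), hρ.bdry_outer_inv,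
    hρ.bdry_outer_ne_zero] with t hmul hinv hne
  rw [← hmul, hinv]
  field_simp

theorem IsHardy.exists_seq_tendsto_mul_bdry_outer (hv : IsHardy v) (hρ : LogIntegrable ρ) :
    ∃ g : ℕ → Torus → ℂ, (∀ j, IsHardy (g j)) ∧
      (∀ j, MemLp (fun t => g j t * bdry (outer ρ) t) 2 ell) ∧
      Tendsto (fun j => ∫ t, ‖v t - g j t * bdry (outer ρ) t‖ ^ 2 ∂ell) atTop (𝓝 0) := by
  obtain ⟨ns, hns⟩ := hρ.exists_seq_tendsto_bdry_outer_cutoff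
  have hgw : ∀ n, (fun t => v t * bdry (outer (cutoff ρ n)) t) =ᵐ[ell]
      fun t => v t * bdry (outer (ρ⁻¹ * cutoff ρ n)) t * bdry (outer ρ) t := fun n => by
    filter_upwards [hρ.bdry_outer_mul_bdry_outer_inv_mul_cutoff n] with t ht
    rw [← ht]
    ring
  have hlim := tendsto_integral_norm_sub_mul_sq hv.memLp
    (fun j => (hρ.isHardy_bdry_outer_cutoff (ns j)).memLp.aestronglyMeasurable)
    (fun j => hρ.norm_bdry_outer_cutoff_le_one (ns j)) hns
  refine ⟨fun j t => v t * bdry (outer (ρ⁻¹ * cutoff ρ (ns j))) t,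
    fun j => hv.mul_of_bounded (hρ.isHardy_bdry_outer_inv_mul_cutoff (ns j))
      (hρ.norm_bdry_outer_inv_mul_cutoff_le (ns j)),
    fun j => (memLp_congr_ae (hgw (ns j))).mp (hv.mul_of_bounded
      (hρ.isHardy_bdry_outer_cutoff (ns j)) (hρ.norm_bdry_outer_cutoff_le_one (ns j))).memLp,
    hlim.congr fun j => integral_congr_ae ?_⟩
  filter_upwards [hgw (ns j)] with t ht
  rw [ht]

theorem IsHardy.mul_bdry_outer_eq_of_cauchyExt_eq_div (hg : IsHardy g) (hv : IsHardy v)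
    (hρ : LogIntegrable ρ)
    (h : ∀ z : ℂ, ‖z‖ < 1 → cauchyExt g z = cauchyExt v z / outer ρ z) :
    (fun t => g t * bdry (outer ρ) t) =ᵐ[ell] v := by
  filter_upwards [hg.ae_tendsto_cauchyExt, hv.ae_tendsto_cauchyExt, hρ.ae_tendsto_bdry_outer]
    with t hgt hvt hwt
  refine tendsto_nhds_unique (tendsto_of_eqOn_ball (fun z hz => ?_) (hgt.mul hwt)) hvt
  rw [h z hz, div_mul_cancel₀ _ (outer_ne_zero ρ z)]

end HardyMulOuter

section Projection

theorem norm_sq_eq_integral (x : L2T) : ‖x‖ ^ 2 = ∫ t, ‖x t‖ ^ 2 ∂ell := by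
  rw [Lp.norm_def, eLpNorm_two_eq_sqrt (Lp.memLp x), ENNReal.toReal_ofReal (Real.sqrt_nonneg _),
    Real.sq_sqrt (integral_nonneg fun t => by positivity)]

theorem norm_sub_toLp_sq (x : L2T) {b : Torus → ℂ} (hb : MemLp b 2 ell) :
    ‖x - hb.toLp‖ ^ 2 = ∫ t, ‖x t - b t‖ ^ 2 ∂ell := by
  rw [norm_sq_eq_integral]
  refine integral_congr_ae ?_
  filter_upwards [Lp.coeFn_sub x hb.toLp, hb.coeFn_toLp] with t hsub hcoe
  rw [hsub, Pi.sub_apply, hcoe]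

theorem fourierCoeff_Pminus (u : L2T) (n : ℤ) :
    fourierCoeff (Pminus u : Torus → ℂ) n =
      if n < 0 then fourierCoeff (u : Torus → ℂ) n else 0 := by
  have hterm : (fun m : ℤ => if m < 0 then fourierCoeff (u : Torus → ℂ) m •
      fourierLp (T := 2 * Real.pi) 2 m else 0) =
      {m : ℤ | m < 0}.indicator fun m => fourierCoeff (u : Torus → ℂ) m • fourierLp 2 m := by
    ext1 m
    rw [Set.indicator_apply]
    rfl
  have hinner : ∀ m, inner ℂ (fourierBasis (T := 2 * Real.pi) n)
      (if m < 0 then fourierCoeff (u : Torus → ℂ) m • fourierLp 2 m else 0) =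
      if m = n then (if m < 0 then fourierCoeff (u : Torus → ℂ) m else 0) else 0 := fun m => by
    rw [coe_fourierBasis, apply_ite (inner ℂ _), inner_smul_right, inner_zero_right,
      orthonormal_iff_ite.mp orthonormal_fourier]
    simp only [mul_ite, mul_one, mul_zero, @eq_comm _ n m]
    split_ifs <;> rfl
  have hsummable := (hasSum_fourier_series_L2 u).summable.indicator {m | m < 0}
  rw [← hterm] at hsummable
  rw [← fourierBasis_repr, fourierBasis.repr_apply_apply, Pminus,
    ← innerSL_apply_apply, (innerSL ℂ _).map_tsum hsummable]
  simp only [innerSL_apply_apply, hinner, tsum_ite_eq]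

theorem fourierCoeff_coe_sub (x y : L2T) (n : ℤ) :
    fourierCoeff (x - y : L2T) n =
      fourierCoeff (x : Torus → ℂ) n - fourierCoeff (y : Torus → ℂ) n := by
  simp only [← fourierBasis_repr, map_sub]
  rfl

theorem sub_Pminus_mem_H2 (u : L2T) : u - Pminus u ∈ H2 := fun n hn => by
  rw [fourierCoeff_coe_sub, fourierCoeff_Pminus, if_pos hn, sub_self]

theorem sub_mem_H2 {x y : L2T} (hx : x ∈ H2) (hy : y ∈ H2) : x - y ∈ H2 := fun n hn => by
  rw [fourierCoeff_coe_sub, hx n hn, hy n hn, sub_self]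

theorem inner_Pminus_eq_zero (u : L2T) {x : L2T} (hx : x ∈ H2) : inner ℂ (Pminus u) x = 0 := by
  refine (fourierBasis.hasSum_inner_mul_inner (Pminus u) x).unique ?_
  convert! hasSum_zero with n
  rw [← inner_conj_symm, ← fourierBasis.repr_apply_apply, ← fourierBasis.repr_apply_apply,
    fourierBasis_repr, fourierBasis_repr, fourierCoeff_Pminus]
  split_ifs with hn
  · rw [hx n hn, mul_zero]
  · rw [map_zero, zero_mul]

theorem norm_sub_sq_eq (u : L2T) {x : L2T} (hx : x ∈ H2) :
    ‖u - x‖ ^ 2 = ‖Pminus u‖ ^ 2 + ‖u - Pminus u - x‖ ^ 2 := by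
  have hdecomp : u - x = Pminus u + (u - Pminus u - x) := by abel
  rw [hdecomp, sq, sq, sq]
  exact norm_add_sq_eq_norm_sq_add_norm_sq_of_inner_eq_zero _ _
    (inner_Pminus_eq_zero u (sub_mem_H2 (sub_Pminus_mem_H2 u) hx))

theorem cauchyExt_sub_Pminus (u : L2T) {z : ℂ} (hz : ‖z‖ < 1) :
    cauchyExt (u - Pminus u : L2T) z = cauchyExt u z := by
  have hsub := hasSum_cauchyExt ((Lp.memLp (u - Pminus u)).integrable one_le_two) hz
  refine hsub.unique ((hasSum_cauchyExt ((Lp.memLp u).integrable one_le_two) hz).congr_fun ?_)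
  intro n
  rw [fourierCoeff_coe_sub, fourierCoeff_Pminus, if_neg (by omega), sub_zero]

theorem exists_seq_mem_H2_tendsto_mul_bdry_outer {ρ : Torus → ℝ} {v : L2T} (hv : v ∈ H2)
    (hρ : LogIntegrable ρ) :
    ∃ g : ℕ → L2T, (∀ j, g j ∈ H2) ∧
      ∃ hgw : ∀ j, MemLp (fun t => g j t * bdry (outer ρ) t) 2 ell,
        Tendsto (fun j => ‖v - (hgw j).toLp‖ ^ 2) atTop (𝓝 0) := by
  obtain ⟨g, hg, hgw, hlim⟩ := (isHardy_of_mem_H2 hv).exists_seq_tendsto_mul_bdry_outer hρ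
  have hcoe : ∀ j, (fun t => ((hg j).memLp.toLp : L2T) t * bdry (outer ρ) t) =ᵐ[ell]
      fun t => g j t * bdry (outer ρ) t := fun j => (hg j).memLp.coeFn_toLp.mul .rfl
  refine ⟨fun j => (hg j).memLp.toLp, fun j => (hg j).toLp_mem_H2,
    fun j => (memLp_congr_ae (hcoe j)).mpr (hgw j), hlim.congr fun j => ?_⟩
  rw [norm_sub_toLp_sq]
  refine integral_congr_ae ?_
  filter_upwards [hcoe j] with t ht
  rw [ht]

end Projection

section Criterion

variable {S : Set Torus} {f w : Torus → ℂ} {M μ : Torus → ℝ}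

theorem concat_of_mem {α : Type*} {h₁ h₂ : Torus → α} {t : Torus} (ht : t ∈ S) :
    concat S h₁ h₂ t = h₁ t := if_pos ht

theorem concat_of_notMem {α : Type*} {h₁ h₂ : Torus → α} {t : Torus} (ht : t ∉ S) :
    concat S h₁ h₂ t = h₂ t := if_neg ht

theorem concat_zero_eq_indicator (a : Torus → ℂ) : concat S a (fun _ => 0) = S.indicator a := by
  classical
  ext1 t
  rw [Set.indicator_apply]
  rfl

theorem memLp_concat_zero (hS : NullMeasurableSet S ell) {a : Torus → ℂ}
    (ha : MemLp a 2 (ell.restrict S)) : MemLp (concat S a fun _ => 0) 2 ell := by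
  have hae := hS.toMeasurable_ae_eq
  rw [← Measure.restrict_congr_set hae,
    ← memLp_indicator_iff_restrict (measurableSet_toMeasurable _ _)] at ha
  rw [concat_zero_eq_indicator]
  exact (memLp_congr_ae (indicator_ae_eq_of_ae_eq_set hae)).mp ha

theorem integral_norm_concat_zero_sub_sq (hS : NullMeasurableSet S ell) {a b : Torus → ℂ}
    (ha : MemLp (concat S a fun _ => 0) 2 ell) (hb : MemLp b 2 ell) :
    ∫ t, ‖concat S a (fun _ => 0) t - b t‖ ^ 2 ∂ell =
      ∫ t in S, ‖a t - b t‖ ^ 2 ∂ell + ∫ t in Sᶜ, ‖b t‖ ^ 2 ∂ell := by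
  have hint : Integrable (fun t => ‖concat S a (fun _ => 0) t - b t‖ ^ 2) ell :=
    (ha.sub hb).integrable_norm_pow two_ne_zero
  rw [← integral_add_compl₀ hS hint]
  congr 1 <;> refine integral_congr_ae ?_
  · filter_upwards [ae_restrict_mem₀ hS] with t ht
    rw [concat_of_mem ht]
  · filter_upwards [ae_restrict_mem₀ hS.compl] with t ht
    rw [concat_of_notMem ht, zero_sub, norm_neg]

theorem eLpNorm_two_sq {α E : Type*} [MeasurableSpace α] [NormedAddCommGroup E]
    {ν : Measure α} {a : α → E} (ha : MemLp a 2 ν) :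
    eLpNorm a 2 ν ^ 2 = ENNReal.ofReal (∫ t, ‖a t‖ ^ 2 ∂ν) := by
  rw [eLpNorm_two_eq_sqrt ha, ← ENNReal.ofReal_pow (Real.sqrt_nonneg _),
    Real.sq_sqrt (integral_nonneg fun t => by positivity)]

theorem eintegral_eq_integral {ν : Measure Torus} {h : Torus → ℝ} (hh : Integrable h ν) :
    eintegral ν h = ((∫ t, h t ∂ν : ℝ) : EReal) := by
  have hneg : ∫⁻ t, ENNReal.ofReal (-h t) ∂ν ≠ ⊤ := hh.neg.lintegral_lt_top.ne
  rw [eintegral, integral_eq_lintegral_pos_part_sub_lintegral_neg_part hh, EReal.coe_sub,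
    EReal.coe_ennreal_toReal hh.lintegral_lt_top.ne,
    EReal.coe_ennreal_toReal hneg]

theorem criterion_eq_of_memLp (hS : NullMeasurableSet S ell) (hf : MemLp f 2 (ell.restrict S))
    (hM : Integrable (fun t => μ t * M t ^ 2) (ell.restrict Sᶜ))
    (hw_mem : ∀ᵐ t ∂ell.restrict S, ‖w t‖ = 1)
    (hw_notMem : ∀ᵐ t ∂ell.restrict Sᶜ, ‖w t‖ ^ 2 = μ t)
    (hfw : MemLp (concat S (fun t => f t * w t) fun _ => 0) 2 ell) {g : L2T}
    (hgw : MemLp (fun t => g t * w t) 2 ell) :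
    criterion S f M μ g =
      ((‖hfw.toLp - hgw.toLp‖ ^ 2 - ∫ t in Sᶜ, μ t * M t ^ 2 ∂ell : ℝ) : EReal) := by
  have hgw_sq := (hgw.restrict Sᶜ).integrable_norm_pow two_ne_zero
  have hJ : (fun t => μ t * (‖g t‖ ^ 2 - M t ^ 2)) =ᵐ[ell.restrict Sᶜ]
      fun t => ‖g t * w t‖ ^ 2 - μ t * M t ^ 2 := by
    filter_upwards [hw_notMem] with t ht
    rw [norm_mul, mul_pow, ht]
    ring
  have hI : ∫ t in S, ‖f t - g t‖ ^ 2 ∂ell = ∫ t in S, ‖f t * w t - g t * w t‖ ^ 2 ∂ell := by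
    refine integral_congr_ae ?_
    filter_upwards [hw_mem] with t ht
    rw [← sub_mul, norm_mul, ht, mul_one]
  have hnorm : ‖hfw.toLp - hgw.toLp‖ ^ 2 =
      ∫ t in S, ‖f t - g t‖ ^ 2 ∂ell + ∫ t in Sᶜ, ‖g t * w t‖ ^ 2 ∂ell := by
    rw [hI, ← integral_norm_concat_zero_sub_sq hS hfw hgw, norm_sub_toLp_sq]
    refine integral_congr_ae ?_
    filter_upwards [hfw.coeFn_toLp] with t ht
    rw [ht]
  have hI_nonneg : 0 ≤ ∫ t in S, ‖f t - g t‖ ^ 2 ∂ell := integral_nonneg fun t => by positivity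
  rw [criterion, eLpNorm_two_sq (a := fun t => f t - g t) (hf.sub ((Lp.memLp g).restrict S)),
    EReal.coe_ennreal_ofReal, max_eq_left hI_nonneg,
    eintegral_eq_integral ((hgw_sq.sub hM).congr hJ.symm), integral_congr_ae hJ,
    integral_sub hgw_sq hM, ← EReal.coe_add, hnorm, add_sub_assoc]

theorem memLp_mul_of_lintegral_ne_top
    (hM : Integrable (fun t => μ t * M t ^ 2) (ell.restrict Sᶜ)) (hw : AEStronglyMeasurable w ell)
    (hw_mem : ∀ᵐ t ∂ell.restrict S, ‖w t‖ = 1)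
    (hw_notMem : ∀ᵐ t ∂ell.restrict Sᶜ, ‖w t‖ ^ 2 = μ t) {g : Torus → ℂ} (hg : MemLp g 2 ell)
    (h : ∫⁻ t in Sᶜ, ENNReal.ofReal (μ t * (‖g t‖ ^ 2 - M t ^ 2)) ∂ell ≠ ⊤) :
    MemLp (fun t => g t * w t) 2 ell := by
  have hgw : AEStronglyMeasurable (fun t => g t * w t) ell := hg.aestronglyMeasurable.mul hw
  have hI : IntegrableOn (fun t => ‖g t * w t‖ ^ 2) S ell := by
    refine (hg.integrable_norm_pow two_ne_zero).restrict.congr ?_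
    filter_upwards [hw_mem] with t ht
    rw [norm_mul, ht, mul_one]
  have hJ : IntegrableOn (fun t => ‖g t * w t‖ ^ 2) Sᶜ ell := by
    refine ⟨(hgw.norm.pow 2).restrict, ?_⟩
    rw [hasFiniteIntegral_iff_ofReal (.of_forall fun t => by positivity)]
    calc ∫⁻ t in Sᶜ, ENNReal.ofReal (‖g t * w t‖ ^ 2) ∂ell
        ≤ ∫⁻ t in Sᶜ, (ENNReal.ofReal (μ t * (‖g t‖ ^ 2 - M t ^ 2)) +
            ENNReal.ofReal (μ t * M t ^ 2)) ∂ell := by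
          refine lintegral_mono_ae ?_
          filter_upwards [hw_notMem] with t ht
          refine le_trans (ENNReal.ofReal_le_ofReal ?_) ENNReal.ofReal_add_le
          rw [norm_mul, mul_pow, ht]
          linarith
      _ = ∫⁻ t in Sᶜ, ENNReal.ofReal (μ t * (‖g t‖ ^ 2 - M t ^ 2)) ∂ell +
            ∫⁻ t in Sᶜ, ENNReal.ofReal (μ t * M t ^ 2) ∂ell :=
          lintegral_add_right' _ hM.aestronglyMeasurable.aemeasurable.ennreal_ofReal
      _ < ⊤ := ENNReal.add_lt_top.mpr ⟨h.lt_top, hM.lintegral_lt_top⟩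
  rw [memLp_two_iff_integrable_sq_norm hgw, ← integrableOn_univ, ← Set.union_compl_self S]
  exact hI.union hJ

theorem criterion_eq_top_of_not_memLp
    (hM : Integrable (fun t => μ t * M t ^ 2) (ell.restrict Sᶜ)) (hw : AEStronglyMeasurable w ell)
    (hw_mem : ∀ᵐ t ∂ell.restrict S, ‖w t‖ = 1)
    (hw_notMem : ∀ᵐ t ∂ell.restrict Sᶜ, ‖w t‖ ^ 2 = μ t) {g : L2T}
    (hgw : ¬ MemLp (fun t => g t * w t) 2 ell) : criterion S f M μ g = ⊤ := by
  have hpos : ∫⁻ t in Sᶜ, ENNReal.ofReal (μ t * (‖g t‖ ^ 2 - M t ^ 2)) ∂ell = ⊤ :=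
    not_not.mp fun h => hgw <|
      memLp_mul_of_lintegral_ne_top hM hw hw_mem hw_notMem (Lp.memLp g) h
  have hneg : ∫⁻ t in Sᶜ, ENNReal.ofReal (-(μ t * (‖g t‖ ^ 2 - M t ^ 2))) ∂ell ≠ ⊤ := by
    refine ne_top_of_le_ne_top hM.lintegral_lt_top.ne (lintegral_mono_ae ?_)
    filter_upwards [hw_notMem] with t ht
    refine ENNReal.ofReal_le_ofReal ?_
    have : 0 ≤ μ t * ‖g t‖ ^ 2 := by
      rw [← ht]
      positivity
    linarith
  rw [criterion, eintegral, hpos, EReal.coe_ennreal_top, ← EReal.coe_ennreal_toReal hneg,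
    EReal.top_sub_coe, EReal.add_top_of_ne_bot (EReal.coe_ennreal_ne_bot _)]

end Criterion

section Weight

variable {S : Set Torus} {f : Torus → ℂ} {M μ : Torus → ℝ}

/-- The boundary modulus `1 ∨ μ^{1/2}` of the outer function `w_{μ^{1/2}} = wSqrt S μ`. -/
noncomputable def sqrtWeight (S : Set Torus) (μ : Torus → ℝ) : Torus → ℝ :=
  concat S (fun _ => 1) fun t => √(μ t)

/-- The function `f w_{μ^{1/2}} ∨ 0`, whose anti-analytic part carries the value of the dual
functional. -/
noncomputable def weightedTrace (S : Set Torus) (f : Torus → ℂ) (μ : Torus → ℝ) : Torus → ℂ :=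
  concat S (fun t => f t * bdry (wSqrt S μ) t) fun _ => 0

theorem wSqrt_eq_outer (S : Set Torus) (μ : Torus → ℝ) : wSqrt S μ = outer (sqrtWeight S μ) := rfl

theorem MemL1Plus.logIntegrable_sqrtWeight (hμ : MemL1Plus S M μ) (hS : NullMeasurableSet S ell) :
    LogIntegrable (sqrtWeight S μ) := by
  refine ⟨ae_of_ae_restrict_of_ae_restrict_compl S ?_ ?_, ?_⟩
  · filter_upwards [ae_restrict_mem₀ hS] with t ht
    rw [sqrtWeight, concat_of_mem ht]
    exact one_pos
  · filter_upwards [ae_restrict_mem₀ hS.compl, hμ.pos] with t ht hpos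
    rw [sqrtWeight, concat_of_notMem ht]
    exact Real.sqrt_pos.mpr hpos
  · have hlog : IntegrableOn (fun t => Real.log (√(μ t))) Sᶜ ell := by
      refine (hμ.integrable_log.div_const 2).congr ?_
      filter_upwards [hμ.pos] with t ht
      rw [Real.log_sqrt ht.le]
    refine (hlog.integrable_indicator₀ hS.compl).congr (.of_forall fun t => ?_)
    dsimp only
    by_cases ht : t ∈ S
    · rw [sqrtWeight, concat_of_mem ht, Real.log_one,
        Set.indicator_of_notMem (Set.notMem_compl_iff.mpr ht)]
    · rw [sqrtWeight, concat_of_notMem ht, Set.indicator_of_mem (Set.mem_compl ht)]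

theorem MemL1Plus.norm_bdry_wSqrt_of_mem (hμ : MemL1Plus S M μ) (hS : NullMeasurableSet S ell) :
    ∀ᵐ t ∂ell.restrict S, ‖bdry (wSqrt S μ) t‖ = 1 := by
  filter_upwards [ae_restrict_of_ae (hμ.logIntegrable_sqrtWeight hS).norm_bdry_outer,
    ae_restrict_mem₀ hS] with t hnorm ht
  rw [wSqrt_eq_outer, hnorm, sqrtWeight, concat_of_mem ht]

theorem MemL1Plus.norm_bdry_wSqrt_sq_of_notMem (hμ : MemL1Plus S M μ)
    (hS : NullMeasurableSet S ell) :
    ∀ᵐ t ∂ell.restrict Sᶜ, ‖bdry (wSqrt S μ) t‖ ^ 2 = μ t := by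
  filter_upwards [ae_restrict_of_ae (hμ.logIntegrable_sqrtWeight hS).norm_bdry_outer,
    ae_restrict_mem₀ hS.compl, hμ.pos] with t hnorm ht hpos
  rw [wSqrt_eq_outer, hnorm, sqrtWeight, concat_of_notMem ht, Real.sq_sqrt hpos.le]

theorem MemL1Plus.aestronglyMeasurable_bdry_wSqrt (hμ : MemL1Plus S M μ)
    (hS : NullMeasurableSet S ell) : AEStronglyMeasurable (bdry (wSqrt S μ)) ell :=
  (hμ.logIntegrable_sqrtWeight hS).aestronglyMeasurable_bdry_outer

theorem MemL1Plus.memLp_weightedTrace (hμ : MemL1Plus S M μ) (hS : NullMeasurableSet S ell)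
    (hf : MemLp f 2 (ell.restrict S)) : MemLp (weightedTrace S f μ) 2 ell := by
  refine memLp_concat_zero hS (hf.of_le
    (hf.aestronglyMeasurable.mul (hμ.aestronglyMeasurable_bdry_wSqrt hS).restrict) ?_)
  filter_upwards [hμ.norm_bdry_wSqrt_of_mem hS] with t ht
  rw [norm_mul, ht, mul_one]

theorem MemL1Plus.eLpNorm_sqrt_mul_sq (hμ : MemL1Plus S M μ) :
    (eLpNorm (fun t => √(μ t) * M t) 2 (ell.restrict Sᶜ)).toReal ^ 2 =
      ∫ t in Sᶜ, μ t * M t ^ 2 ∂ell := by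
  have hnorm : ∀ᵐ t ∂ell.restrict Sᶜ, ‖√(μ t) * M t‖ = ‖√(μ t * M t ^ 2)‖ := by
    filter_upwards [hμ.pos] with t ht
    rw [Real.sqrt_mul ht.le, Real.sqrt_sq_eq_abs, norm_mul, norm_mul, norm_abs_eq_norm]
  have hsq : (fun t => ‖√(μ t * M t ^ 2)‖ ^ 2) =ᵐ[ell.restrict Sᶜ] fun t => μ t * M t ^ 2 := by
    filter_upwards [hμ.pos] with t ht
    rw [Real.norm_eq_abs, sq_abs, Real.sq_sqrt (by positivity)]
  have hmem : MemLp (fun t => √(μ t * M t ^ 2)) 2 (ell.restrict Sᶜ) :=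
    (memLp_two_iff_integrable_sq_norm (Real.continuous_sqrt.comp_aestronglyMeasurable
      hμ.integrable.aestronglyMeasurable)).mpr (hμ.integrable.congr hsq.symm)
  rw [eLpNorm_congr_norm_ae hnorm, ← ENNReal.toReal_pow, eLpNorm_two_sq hmem,
    ENNReal.toReal_ofReal (integral_nonneg fun t => by positivity), integral_congr_ae hsq]

theorem carleman_eq_cauchyExt_weightedTrace_div (hS : NullMeasurableSet S ell) (z : ℂ) :
    carleman S f μ z = cauchyExt (weightedTrace S f μ) z / wSqrt S μ z := by
  have hfactor : 1 / (2 * Complex.I * Real.pi * wSqrt S μ z) =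
      1 / (2 * Complex.I * Real.pi) / wSqrt S μ z := by
    rw [div_div]
  rw [carleman, hfactor, div_mul_eq_mul_div, one_div_mul_lineIntegral_div,
    cauchyExt_eq_integral, ← integral_indicator₀ hS]
  refine congrArg (· / wSqrt S μ z) (integral_congr_ae (.of_forall fun t => ?_))
  dsimp only
  by_cases ht : t ∈ S
  · rw [weightedTrace, concat_of_mem ht, Set.indicator_of_mem ht]
    ring
  · rw [weightedTrace, concat_of_notMem ht, Set.indicator_of_notMem ht, zero_mul]

theorem carleman_eq_cauchyExt_sub_Pminus_div (hS : NullMeasurableSet S ell)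
    (hu : MemLp (weightedTrace S f μ) 2 ell) {z : ℂ} (hz : ‖z‖ < 1) :
    carleman S f μ z = cauchyExt (hu.toLp - Pminus hu.toLp : L2T) z / wSqrt S μ z := by
  rw [carleman_eq_cauchyExt_weightedTrace_div hS, cauchyExt_sub_Pminus _ hz,
    cauchyExt_congr_ae hu.coeFn_toLp]

end Weight

section Duality

variable {S : Set Torus} {f : Torus → ℂ} {M μ : Torus → ℝ}

theorem criterion_eq_norm_Pminus (hS : NullMeasurableSet S ell)
    (hf : MemLp f 2 (ell.restrict S)) (hμ : MemL1Plus S M μ)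
    (hu : MemLp (weightedTrace S f μ) 2 ell) {g : L2T} (hg : g ∈ H2)
    (hgw : MemLp (fun t => g t * bdry (wSqrt S μ) t) 2 ell) :
    criterion S f M μ g = ((‖Pminus hu.toLp‖ ^ 2 + ‖hu.toLp - Pminus hu.toLp - hgw.toLp‖ ^ 2 -
      ∫ t in Sᶜ, μ t * M t ^ 2 ∂ell : ℝ) : EReal) := by
  have hgw_mem : hgw.toLp ∈ H2 :=
    ((isHardy_of_mem_H2 hg).mul_bdry_outer (hμ.logIntegrable_sqrtWeight hS) hgw).toLp_mem_H2
  rw [criterion_eq_of_memLp hS hf hμ.integrable (hμ.norm_bdry_wSqrt_of_mem hS)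
    (hμ.norm_bdry_wSqrt_sq_of_notMem hS) hu hgw, ← norm_sub_sq_eq _ hgw_mem]
  rfl

theorem le_dualFunctional (hS : NullMeasurableSet S ell) (hf : MemLp f 2 (ell.restrict S))
    (hμ : MemL1Plus S M μ) (hu : MemLp (weightedTrace S f μ) 2 ell) :
    ((‖Pminus hu.toLp‖ ^ 2 - ∫ t in Sᶜ, μ t * M t ^ 2 ∂ell : ℝ) : EReal) ≤
      dualFunctional S f M μ := by
  refine le_iInf₂ fun g hg => ?_
  by_cases hgw : MemLp (fun t => g t * bdry (wSqrt S μ) t) 2 ell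
  · rw [criterion_eq_norm_Pminus hS hf hμ hu hg hgw, EReal.coe_le_coe_iff]
    linarith [sq_nonneg ‖hu.toLp - Pminus hu.toLp - hgw.toLp‖]
  · rw [criterion_eq_top_of_not_memLp hμ.integrable (hμ.aestronglyMeasurable_bdry_wSqrt hS)
      (hμ.norm_bdry_wSqrt_of_mem hS) (hμ.norm_bdry_wSqrt_sq_of_notMem hS) hgw]
    exact le_top

theorem dualFunctional_eq (hS : NullMeasurableSet S ell) (hf : MemLp f 2 (ell.restrict S))
    (hμ : MemL1Plus S M μ) (hu : MemLp (weightedTrace S f μ) 2 ell) :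
    dualFunctional S f M μ =
      ((‖Pminus hu.toLp‖ ^ 2 - ∫ t in Sᶜ, μ t * M t ^ 2 ∂ell : ℝ) : EReal) := by
  refine le_antisymm ?_ (le_dualFunctional hS hf hμ hu)
  obtain ⟨g, hg, hgw, hlim⟩ := exists_seq_mem_H2_tendsto_mul_bdry_outer
    (sub_Pminus_mem_H2 hu.toLp) (hμ.logIntegrable_sqrtWeight hS)
  have hvalue : ∀ j, dualFunctional S f M μ ≤ ((‖Pminus hu.toLp‖ ^ 2 +
      ‖hu.toLp - Pminus hu.toLp - (hgw j).toLp‖ ^ 2 -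
      ∫ t in Sᶜ, μ t * M t ^ 2 ∂ell : ℝ) : EReal) := fun j =>
    (iInf₂_le _ (hg j)).trans_eq (criterion_eq_norm_Pminus hS hf hμ hu (hg j) (hgw j))
  have hvalue_lim := (hlim.const_add (‖Pminus hu.toLp‖ ^ 2)).sub_const
    (∫ t in Sᶜ, μ t * M t ^ 2 ∂ell)
  rw [add_zero] at hvalue_lim
  exact ge_of_tendsto' ((continuous_coe_real_ereal.tendsto _).comp hvalue_lim) hvalue

theorem criterion_eq_dualFunctional_of_isH2With_carleman (hS : NullMeasurableSet S ell)
    (hf : MemLp f 2 (ell.restrict S)) (hμ : MemL1Plus S M μ) {g : L2T}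
    (hg : IsH2With (carleman S f μ) g) :
    criterion S f M μ g = dualFunctional S f M μ := by
  have hu := hμ.memLp_weightedTrace hS hf
  have hproj := sub_Pminus_mem_H2 hu.toLp
  have hgw_ae := (isHardy_of_mem_H2 hg.1).mul_bdry_outer_eq_of_cauchyExt_eq_div
    (isHardy_of_mem_H2 hproj) (hμ.logIntegrable_sqrtWeight hS) fun z hz =>
      (hg.2 z (mem_ball_zero_iff.mpr hz)).symm.trans
        (carleman_eq_cauchyExt_sub_Pminus_div hS hu hz)
  have hgw : MemLp (fun t => g t * bdry (wSqrt S μ) t) 2 ell :=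
    (memLp_congr_ae hgw_ae).mpr (Lp.memLp _)
  have hgw_eq : hgw.toLp = hu.toLp - Pminus hu.toLp := Lp.ext (hgw.coeFn_toLp.trans hgw_ae)
  rw [criterion_eq_norm_Pminus hS hf hμ hu hg.1 hgw, dualFunctional_eq hS hf hμ hu, hgw_eq,
    sub_self, norm_zero, zero_pow two_ne_zero, add_zero]

theorem exists_ae_inv_sqrtWeight_le (hS : NullMeasurableSet S ell)
    (hμ : MemLp (fun t => (μ t)⁻¹) ⊤ (ell.restrict Sᶜ)) :
    ∃ C : ℝ, ∀ᵐ t ∂ell, (sqrtWeight S μ)⁻¹ t ≤ C := by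
  refine ⟨max 1 (√(lpNorm (fun t => (μ t)⁻¹) ⊤ (ell.restrict Sᶜ))),
    ae_of_ae_restrict_of_ae_restrict_compl S ?_ ?_⟩
  · filter_upwards [ae_restrict_mem₀ hS] with t ht
    rw [Pi.inv_apply, sqrtWeight, concat_of_mem ht, inv_one]
    exact le_max_left _ _
  · filter_upwards [ae_restrict_mem₀ hS.compl, ae_le_lpNorm_exponent_top hμ] with t ht hle
    rw [Pi.inv_apply, sqrtWeight, concat_of_notMem ht, ← Real.sqrt_inv]
    exact (Real.sqrt_le_sqrt ((le_abs_self _).trans hle)).trans (le_max_right _ _)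

theorem exists_isH2With_carleman (hS : NullMeasurableSet S ell)
    (hf : MemLp f 2 (ell.restrict S)) (hμ : MemL1Plus S M μ)
    (hμ_inv : MemLp (fun t => (μ t)⁻¹) ⊤ (ell.restrict Sᶜ)) :
    ∃ g : L2T, IsH2With (carleman S f μ) g := by
  obtain ⟨C, hC⟩ := exists_ae_inv_sqrtWeight_le hS hμ_inv
  have hu := hμ.memLp_weightedTrace hS hf
  have hρ := (hμ.logIntegrable_sqrtWeight hS).inv
  have hproj := isHardy_of_mem_H2 (sub_Pminus_mem_H2 hu.toLp)
  have hinv := hρ.isHardy_bdry_outer hC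
  have hg := hproj.mul_of_bounded hinv
    (hρ.norm_bdry_outer.mp (hC.mono fun t hle hnorm => hnorm.trans_le hle))
  refine ⟨hg.memLp.toLp, hg.toLp_mem_H2, fun z hz => ?_⟩
  rw [mem_ball_zero_iff] at hz
  rw [cauchyExt_congr_ae hg.memLp.coeFn_toLp, hproj.cauchyExt_mul hinv hz,
    hρ.cauchyExt_bdry_outer hC hz, outer_inv, ← wSqrt_eq_outer, ← div_eq_mul_inv,
    carleman_eq_cauchyExt_sub_Pminus_div hS hu hz]

end Duality

end HardyDual

open HardyDual in
theorem mainTheorem10_general {S : Set Torus} (hS : NullMeasurableSet S ell) {M : Torus → ℝ}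
    {f : Torus → ℂ} (hf : MemLp f 2 (ell.restrict S)) {μ : Torus → ℝ} (hμ : MemL1Plus S M μ) :
    (∃ hu : MemLp (concat S (fun t => f t * bdry (wSqrt S μ) t) (fun _ => 0)) 2 ell,
      dualFunctional S f M μ =
        ((‖Pminus hu.toLp‖ ^ 2 -
          (eLpNorm (fun t => √(μ t) * M t) 2 (ell.restrict Sᶜ)).toReal ^ 2 : ℝ) : EReal)) ∧
    (∀ g : L2T, IsH2With (carleman S f μ) g →
      IsMinOn (criterion S f M μ) H2 g ∧ criterion S f M μ g = dualFunctional S f M μ) ∧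
    (MemLp (fun t => (μ t)⁻¹) ⊤ (ell.restrict Sᶜ) →
      ∃ g : L2T, IsH2With (carleman S f μ) g) := by
  refine ⟨⟨hμ.memLp_weightedTrace hS hf, ?_⟩, fun g hg => ?_, exists_isH2With_carleman hS hf hμ⟩
  · rw [hμ.eLpNorm_sqrt_mul_sq]
    exact dualFunctional_eq hS hf hμ (hμ.memLp_weightedTrace hS hf)
  · have hvalue := criterion_eq_dualFunctional_of_isH2With_carleman hS hf hμ hg
    exact ⟨fun x hx => hvalue.trans_le (iInf₂_le x hx), hvalue⟩

theorem mainTheorem10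
    (S : Set HardyDual.Torus)
    (hS : NullMeasurableSet S HardyDual.ell)
    (hS_pos : 0 < HardyDual.ell S)
    (hJ_pos : 0 < HardyDual.ell Sᶜ)
    (hS_bdry : HardyDual.ell (frontier S) = 0)
    (M : HardyDual.Torus → ℝ)
    (hM : MemLp M 2 (HardyDual.ell.restrict Sᶜ))
    (hM_pos : ∀ᵐ t ∂HardyDual.ell.restrict Sᶜ, 0 < M t)
    (hM_log : Integrable (fun t => Real.log (M t)) (HardyDual.ell.restrict Sᶜ))
    (f : HardyDual.Torus → ℂ)
    (hf : MemLp f 2 (HardyDual.ell.restrict S))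
    (hf_not : ¬ ∃ g ∈ HardyDual.H2,
      (∀ᵐ t ∂HardyDual.ell.restrict S, f t = g t) ∧
      ∀ᵐ t ∂HardyDual.ell.restrict Sᶜ, ‖g t‖ ≤ M t)
    (μ : HardyDual.Torus → ℝ)
    (hμ : HardyDual.MemL1Plus S M μ) :
    (∃ hu : MemLp
        (HardyDual.concat S (fun t => f t * HardyDual.bdry (HardyDual.wSqrt S μ) t) (fun _ => 0))
        2 HardyDual.ell,
      HardyDual.dualFunctional S f M μ =
        ((‖HardyDual.Pminus hu.toLp‖ ^ 2 -
          (eLpNorm (fun t => Real.sqrt (μ t) * M t) 2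
            (HardyDual.ell.restrict Sᶜ)).toReal ^ 2 : ℝ) : EReal)) ∧
    (∀ g : HardyDual.L2T, HardyDual.IsH2With (HardyDual.carleman S f μ) g →
      IsMinOn (HardyDual.criterion S f M μ) HardyDual.H2 g ∧
      HardyDual.criterion S f M μ g = HardyDual.dualFunctional S f M μ) ∧
    (MemLp (fun t => (μ t)⁻¹) ⊤ (HardyDual.ell.restrict Sᶜ) →
      ∃ g : HardyDual.L2T, HardyDual.IsH2With (HardyDual.carleman S f μ) g) :=
  mainTheorem10_general hS hf hμ
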